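/- Let $W$ be a binary-input memoryless output-symmetric channel with Shannon capacity $C\in(0,1)$ (in bits) and Bhattacharyya parameter $Z=\sum_{y}\sqrt{W(y|0)W(y|1)}\in(0,1)$ (an integral of the transition densities if the output alphabet is not discrete). For $N=2^n$, the polar code for $W$ of block length $N$ and rate $R=K/N$ is the binary linear code generated by the $K$ rows of $\left(\begin{smallmatrix}1&0\\1&1\end{smallmatrix}\right)^{\otimes n}$ whose synthetic channels $W_N^{(i)}$ have the smallest Bhattacharyya parameters (ties broken arbitrarily); rates $R\le C$ are considered. Let $P_e^{\rm MAP}(N,R,W,L)$ denote its block error probability over $W$, for equiprobable messages, under MAP decoding with list size $L\ge 1$, an error being declared when at least $L$ messages other than the transmitted one are at least as likely, given the channel output, as the transmitted one. Fix $P_e\in(0,1)$ and pick any $N=2^n$ such that $N>2^{\bar n(Z,C,P_e)}$, where $$\bar n(Z,C,P_e)=2\bar m(Z,P_e)-\ln(1-C)+\sqrt{-4\,\bar m(Z,P_e)\ln(1-C)+(\ln(1-C))^2},$$ $$\bar m(Z,P_e)=\log_2\left(\frac{2\ln(P_e/8)\cdot\ln(1-Z)}{\ln Z\cdot\ln\bigl(1-Z^{\frac{4\ln(P_e/8)}{\ln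 Z}}\bigr)}\right)$$ (the square root being read as $0$ if its argument is negative), and any rate $R\le C$ large enough that $P_e^{\rm MAP}(N,R,W,L)>P_e$. Then $$P_e^{\rm MAP}(N,R,W,L+1)\ \ge\ \tfrac{3}{16}\bigl(P_e^{\rm MAP}(N,R,W,L)\bigr)^2,$$ and, if $W$ is the binary erasure channel ${\rm BEC}(\varepsilon)$, also $$P_e^{\rm MAP}(N,R,W,2L)\ \ge\ \tfrac{3}{16}\bigl(P_e^{\rm MAP}(N,R,W,L)\bigr)^2.$$ -/

import Mathlib

universe u

open MeasureTheory

namespace PolarList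

/-- A binary-input memoryless channel. The input alphabet is `{0, 1} = ZMod 2`, the output
alphabet is an arbitrary measurable space `Out`, and the transition probabilities `W(y|x)` are
given by densities `p x y` with respect to a `σ`-finite measure `ref` on `Out`. A discrete output
alphabet is the case where `ref` is the counting measure; then `p x y` is the probability of
receiving `y` when `x` is sent, and integrals against `ref` are sums over `Out`. -/
structure Channel : Type (u + 1) where
  /-- the output alphabet -/
  Out : Type u
  /-- its `σ`-algebra -/
  mOut : MeasurableSpace Out
  /-- the reference measure -/
  ref : Measure Out
  ref_sigmaFinite : SigmaFinite ref
  /-- the transition densities -/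
  p : ZMod 2 → Out → ℝ
  p_measurable : ∀ x, Measurable (p x)
  p_nonneg : ∀ x y, 0 ≤ p x y
  p_integral : ∀ x, ∫ y, p x y ∂ref = 1

namespace Channel

attribute [instance] Channel.mOut Channel.ref_sigmaFinite

/-- Output symmetry: there is an involution `π` of the output alphabet with
`W(y|1) = W(π y|0)`. (In the discrete case every bijection preserves the counting measure.) -/
def IsSymmetric (W : Channel.{u}) : Prop :=
  ∃ π : W.Out → W.Out, Function.Involutive π ∧ MeasurePreserving π W.ref W.ref ∧
    ∀ y, W.p 1 y = W.p 0 (π y)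

/-- The law of the channel output when `x` is sent. -/
noncomputable def law (W : Channel.{u}) (x : ZMod 2) : Measure W.Out :=
  W.ref.withDensity fun y => ENNReal.ofReal (W.p x y)

/-- The Bhattacharyya parameter `Z(W) = ∑_y √(W(y|0) W(y|1))`. -/
noncomputable def bhattacharyya (W : Channel.{u}) : ℝ :=
  ∫ y, Real.sqrt (W.p 0 y * W.p 1 y) ∂W.ref

/-- The mutual information, in bits, between the input and the output of the channel when the
input has distribution `P`: `I(X;Y) = ∑_x P(x) D(W(·|x) ‖ ∑_x' P(x') W(·|x'))`. -/
noncomputable def mutualInfo (W : Channel.{u}) (P : PMF (ZMod 2)) : ℝ :=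
  ∑ x : ZMod 2, (P x).toReal *
    ((InformationTheory.klDiv (W.law x) (∑ x' : ZMod 2, P x' • W.law x')).toReal / Real.log 2)

/-- The Shannon capacity, in bits per channel use. -/
noncomputable def capacity (W : Channel.{u}) : ℝ :=
  ⨆ P : PMF (ZMod 2), W.mutualInfo P

section Block

variable {ι : Type*} [Fintype ι]

/-- The law of the output block when the word `c` is sent by independent uses of the channel. -/
noncomputable def blockLaw (W : Channel.{u}) (c : ι → ZMod 2) : Measure (ι → W.Out) :=
  Measure.pi fun i => W.law (c i)

/-- The likelihood `p(y|c) = ∏ᵢ W(yᵢ|cᵢ)`. -/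
noncomputable def likelihood (W : Channel.{u}) (c : ι → ZMod 2) (y : ι → W.Out) : ℝ :=
  ∏ i, W.p (c i) (y i)

/-- The event that MAP decoding with list size `L` fails when the message `m` is sent: at least
`L` other messages are at least as likely as `m` given the output, so that `m` is not guaranteed
a place in the list (ties count as errors). -/
def mapErrorEvent (W : Channel.{u}) {M : Type*} (enc : M → ι → ZMod 2) (L : ℕ) (m : M) :
    Set (ι → W.Out) :=
  {y | L ≤ Set.ncard {m' : M | m' ≠ m ∧ W.likelihood (enc m) y ≤ W.likelihood (enc m') y}}

/-- The block error probability under MAP decoding with list size `L`, for equiprobable messages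
`m : M` encoded by `enc`. -/
noncomputable def mapError (W : Channel.{u}) {M : Type*} [Fintype M] (enc : M → ι → ZMod 2)
    (L : ℕ) : ℝ :=
  (Fintype.card M : ℝ)⁻¹ * ∑ m : M, (W.blockLaw (enc m)).real (W.mapErrorEvent enc L m)

end Block

theorem p_integrable (W : Channel.{u}) (x : ZMod 2) : Integrable (W.p x) W.ref := by
  by_contra h
  have h1 := W.p_integral x
  rw [integral_undef h] at h1
  exact zero_ne_one h1

/-- The density of `W⁻`. -/
noncomputable def minusDensity (W : Channel.{u}) (u : ZMod 2) (y : W.Out × W.Out) : ℝ :=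
  ∑ v : ZMod 2, 2⁻¹ * (W.p (u + v) y.1 * W.p v y.2)

/-- The density of `W⁺`. -/
noncomputable def plusDensity (W : Channel.{u}) (v : ZMod 2)
    (y : (W.Out × W.Out) × ZMod 2) : ℝ :=
  2⁻¹ * (W.p (y.2 + v) y.1.1 * W.p v y.1.2)

theorem minusDensity_integral (W : Channel.{u}) (u : ZMod 2) :
    ∫ y, W.minusDensity u y ∂(W.ref.prod W.ref) = 1 := by
  unfold minusDensity
  rw [integral_finsetSum]
  · have h : ∀ v : ZMod 2, ∫ y : W.Out × W.Out, 2⁻¹ * (W.p (u + v) y.1 * W.p v y.2)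
        ∂(W.ref.prod W.ref) = 2⁻¹ := by
      intro v
      rw [integral_const_mul, integral_prod_mul, W.p_integral, W.p_integral]
      norm_num
    simp [h, ZMod.card]
  · intro v _
    exact ((W.p_integrable _).mul_prod (W.p_integrable _)).const_mul _

theorem plusDensity_eq (W : Channel.{u}) (v : ZMod 2) (y : (W.Out × W.Out) × ZMod 2) :
    W.plusDensity v y =
      ∑ a : ZMod 2, (2⁻¹ * (W.p (a + v) y.1.1 * W.p v y.1.2)) * (if y.2 = a then 1 else 0) := by
  simp [plusDensity]

theorem plusDensity_measurable (W : Channel.{u}) (v : ZMod 2) :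
    Measurable (W.plusDensity v) := by
  have h : W.plusDensity v = fun y => ∑ a : ZMod 2,
      (2⁻¹ * (W.p (a + v) y.1.1 * W.p v y.1.2)) * (if y.2 = a then 1 else 0) :=
    funext (W.plusDensity_eq v)
  rw [h]
  have hp := W.p_measurable
  have hq : ∀ a : ZMod 2, Measurable fun y : (W.Out × W.Out) × ZMod 2 =>
      (if y.2 = a then (1 : ℝ) else 0) := fun a =>
    (measurable_of_countable fun b : ZMod 2 => (if b = a then (1 : ℝ) else 0)).comp measurable_snd
  fun_prop

theorem plusDensity_integral (W : Channel.{u}) (v : ZMod 2) :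
    ∫ y, W.plusDensity v y ∂((W.ref.prod W.ref).prod Measure.count) = 1 := by
  have hint : ∀ a : ZMod 2, Integrable
      (fun z : W.Out × W.Out => 2⁻¹ * (W.p (a + v) z.1 * W.p v z.2)) (W.ref.prod W.ref) :=
    fun a => ((W.p_integrable _).mul_prod (W.p_integrable _)).const_mul _
  simp only [plusDensity_eq]
  rw [integral_finsetSum]
  · have h : ∀ a : ZMod 2, ∫ y : (W.Out × W.Out) × ZMod 2,
        (2⁻¹ * (W.p (a + v) y.1.1 * W.p v y.1.2)) * (if y.2 = a then 1 else 0)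
        ∂((W.ref.prod W.ref).prod Measure.count) = 2⁻¹ := by
      intro a
      rw [integral_prod_mul (fun z : W.Out × W.Out => 2⁻¹ * (W.p (a + v) z.1 * W.p v z.2))
        (fun b : ZMod 2 => (if b = a then (1 : ℝ) else 0)),
        integral_const_mul, integral_prod_mul, W.p_integral, W.p_integral]
      simp [integral_fintype, Integrable.of_finite]
    rw [Finset.sum_congr rfl fun a _ => h a]
    simp [ZMod.card]
  · intro a _
    exact (hint a).mul_prod (Integrable.of_finite (f := fun b : ZMod 2 =>
      (if b = a then (1 : ℝ) else 0)))

/-- The worse of the two channels produced from two uses of `W` by the polar transform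
`(u₁, u₂) ↦ (u₁ + u₂, u₂)`: `W⁻(y₁, y₂ | u₁) = ∑_{u₂} ½ W(y₁|u₁+u₂) W(y₂|u₂)`. -/
noncomputable def minus (W : Channel.{u}) : Channel.{u} where
  Out := W.Out × W.Out
  mOut := inferInstance
  ref := W.ref.prod W.ref
  ref_sigmaFinite := inferInstance
  p := W.minusDensity
  p_measurable := fun x => by
    have hp := W.p_measurable
    unfold minusDensity
    fun_prop
  p_nonneg := fun x y => Finset.sum_nonneg fun v _ =>
    mul_nonneg (by norm_num) (mul_nonneg (W.p_nonneg _ _) (W.p_nonneg _ _))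
  p_integral := W.minusDensity_integral

/-- The better of the two channels: `W⁺(y₁, y₂, u₁ | u₂) = ½ W(y₁|u₁+u₂) W(y₂|u₂)`. -/
noncomputable def plus (W : Channel.{u}) : Channel.{u} where
  Out := (W.Out × W.Out) × ZMod 2
  mOut := inferInstance
  ref := (W.ref.prod W.ref).prod Measure.count
  ref_sigmaFinite := inferInstance
  p := W.plusDensity
  p_measurable := W.plusDensity_measurable
  p_nonneg := fun x y =>
    mul_nonneg (by norm_num) (mul_nonneg (W.p_nonneg _ _) (W.p_nonneg _ _))
  p_integral := W.plusDensity_integral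

/-- The synthetic channel `W_N^{(i)}`, `N = 2^n`. The index `i ∈ {1, …, N}` is represented by the
binary expansion `b 0, …, b (n-1)` of `i - 1`, most significant bit first; the transforms are
applied in this order, a bit `0` giving `W ↦ W⁻` and a bit `1` giving `W ↦ W⁺`. -/
noncomputable def synthetic (W : Channel.{u}) : (n : ℕ) → (Fin n → Fin 2) → Channel.{u}
  | 0, _ => W
  | n + 1, b => synthetic (if b 0 = 0 then W.minus else W.plus) n (fun t => b t.succ)

/-- `A` is the set of unfrozen indices of a polar code of block length `2^n` for `W`: it consists
of `A.card` indices whose synthetic channels have the smallest Bhattacharyya parameters (ties may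
be broken in any way). -/
def IsPolarCode (W : Channel.{u}) {n : ℕ} (A : Finset (Fin n → Fin 2)) : Prop :=
  ∀ i ∈ A, ∀ j ∉ A, (W.synthetic n i).bhattacharyya ≤ (W.synthetic n j).bhattacharyya

end Channel

/-- The kernel `F = [1 0; 1 1]`. -/
def polarKernel : Matrix (Fin 2) (Fin 2) (ZMod 2) := !![1, 0; 1, 1]

/-- The Kronecker power `F^{⊗n}`, rows and columns being indexed by binary expansions. -/
def polarMatrix (n : ℕ) : Matrix (Fin n → Fin 2) (Fin n → Fin 2) (ZMod 2) :=
  Matrix.of fun i j => ∏ t, polarKernel (i t) (j t)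

/-- The encoder of the polar code with unfrozen set `A`: the information vector `u` is mapped to
`u G`, where `G` consists of the rows of `F^{⊗n}` with index in `A` (frozen bits are `0`). -/
def polarEncode {n : ℕ} (A : Finset (Fin n → Fin 2)) (u : A → ZMod 2) :
    (Fin n → Fin 2) → ZMod 2 :=
  Matrix.vecMul u ((polarMatrix n).submatrix (fun i : A => (i : Fin n → Fin 2)) id)

/-- The rate `R = K / N` of the polar code with unfrozen set `A`, where `K = |A|`, `N = 2^n`. -/
noncomputable def polarRate {n : ℕ} (A : Finset (Fin n → Fin 2)) : ℝ :=
  (A.card : ℝ) / 2 ^ n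

/-- `P_e^MAP(N, R, W, L)` for the polar code with unfrozen set `A`. -/
noncomputable def polarMapError (W : Channel.{u}) {n : ℕ} (A : Finset (Fin n → Fin 2))
    (L : ℕ) : ℝ :=
  W.mapError (polarEncode A) L

/-- The output alphabet of the binary erasure channel: a received bit, or an erasure. -/
inductive ErasureOut : Type u
  | bit (b : ZMod 2)
  | erased

instance : MeasurableSpace ErasureOut.{u} := ⊤

instance : DiscreteMeasurableSpace ErasureOut.{u} := ⟨fun _ => trivial⟩

/-- Its elements are those of `Option (ZMod 2)`. -/
def ErasureOut.equivOption : ErasureOut.{u} ≃ Option (ZMod 2) where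
  toFun
    | .bit b => some b
    | .erased => none
  invFun
    | some b => .bit b
    | none => .erased
  left_inv y := by cases y <;> rfl
  right_inv y := by cases y <;> rfl

instance : Fintype ErasureOut.{u} := Fintype.ofEquiv _ ErasureOut.equivOption.symm

/-- The transition probabilities of the binary erasure channel. -/
def erasureProb (ε : ℝ) (x : ZMod 2) : ErasureOut.{u} → ℝ
  | .bit b => if b = x then 1 - ε else 0
  | .erased => ε

/-- The binary erasure channel `BEC(ε)`. -/
noncomputable def BEC (ε : ℝ) (h : ε ∈ Set.Icc (0 : ℝ) 1) : Channel.{u} where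
  Out := ErasureOut.{u}
  mOut := inferInstance
  ref := Measure.count
  ref_sigmaFinite := inferInstance
  p := erasureProb ε
  p_measurable := fun _ => measurable_of_countable _
  p_nonneg := fun x y => by
    have h0 := h.1
    have h1 := h.2
    cases y with
    | bit b => simp only [erasureProb]; split_ifs <;> linarith
    | erased => exact h0
  p_integral := fun x => by
    rw [integral_fintype Integrable.of_finite, ← ErasureOut.equivOption.symm.sum_comp]
    simp [ErasureOut.equivOption, erasureProb, Fintype.sum_option]

/-- The constant `m̄(Z, P_e)`. -/
noncomputable def mBar (Z Pe : ℝ) : ℝ :=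
  Real.logb 2 ((2 * Real.log (Pe / 8) * Real.log (1 - Z)) /
    (Real.log Z * Real.log (1 - Z ^ (4 * Real.log (Pe / 8) / Real.log Z))))

/-- The constant `n̄(Z, C, P_e)`. -/
noncomputable def nBar (Z C Pe : ℝ) : ℝ :=
  2 * mBar Z Pe - Real.log (1 - C) +
    Real.sqrt (-4 * mBar Z Pe * Real.log (1 - C) + Real.log (1 - C) ^ 2)

end PolarList

/-! By linearity and output symmetry, the error probability may be computed for the zero word. An
error for list size `L` then means that more than `L` messages, counting `0`, are at least as likely
as `0`. Up to a null set this event is a union of events "all messages of `S` are confusable with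
`0`", and each of these is increasing in the likelihood ratios of the individual outputs.

Suppose each such event has probability at most one eighth of `P`, the probability of the union.
Then the family splits into two subfamilies whose unions have probability at least `3P/8` and `P/2`.
By Harris' inequality both unions occur together with probability at least `3P²/16`, and then two
different sets `S` are confusable (`three_sixteenths_le`). With sets of size `L + 1`, two of them
contain at least `L + 2` messages. On the erasure channel the confusable messages form a subgroup,
so minimal subgroups with more than `L` elements may be used instead; two of them generate one with
more than `2L` elements.

Each event is small if the minimum distance `d` satisfies `Z^d ≤ Pe/8`, by the Bhattacharyya bound.
The distance is at least `2^w` for the lightest unfrozen row weight `2^w`, so light rows must be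
excluded (`Channel.IsPolarCode.log_div_log_le`). By Hoeffding's bound and `R ≤ C < 1`, some frozen
index has weight above `mBar`. One-step bounds on the Bhattacharyya parameter, iterated, show that a
very light index has a strictly worse synthetic channel than this frozen one, so it cannot be
unfrozen. -/

namespace PolarList

/-! ### Harris' inequality and the splitting of a union of increasing events. -/

section Harris

variable {X : Type*} [MeasurableSpace X] {μ : Measure X} [IsProbabilityMeasure μ]

/-- Chebyshev's integral inequality for functions that vary in the same direction. -/
theorem integral_mul_integral_le_of_monovary {F G : X → ℝ} (hF : Integrable F μ)
    (hG : Integrable G μ) (hFG : Integrable (fun x => F x * G x) μ)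
    (h : ∀ x y, 0 ≤ (F x - F y) * (G x - G y)) :
    (∫ x, F x ∂μ) * ∫ x, G x ∂μ ≤ ∫ x, F x * G x ∂μ := by
  set a := ∫ x, F x ∂μ
  set b := ∫ x, G x ∂μ
  set c := ∫ x, F x * G x ∂μ
  -- Averaging the nonnegative product over `y`, and afterwards over `x`, gives `2 (c - a b) ≥ 0`.
  have h1 : ∀ x, 0 ≤ F x * G x - F x * b - a * G x + c := by
    intro x
    have e : ∫ y, (F x - F y) * (G x - G y) ∂μ = F x * G x - F x * b - a * G x + c := by
      have e' : ∀ y, (F x - F y) * (G x - G y)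
          = F x * G x - F x * G y - F y * G x + F y * G y := fun y => by ring
      simp only [e']
      rw [integral_add, integral_sub, integral_sub, integral_const_mul, integral_mul_const,
        integral_const]
      · simp [integral_const_mul, a, b, c]
      · exact integrable_const _
      · exact hG.const_mul _
      · exact (integrable_const _).sub (hG.const_mul _)
      · exact hF.mul_const _
      · exact ((integrable_const _).sub (hG.const_mul _)).sub (hF.mul_const _)
      · exact hFG
    rw [← e]
    exact integral_nonneg fun y => h x y
  have h2 : ∫ x, (F x * G x - F x * b - a * G x + c) ∂μ = c - a * b - a * b + c := by
    rw [integral_add, integral_sub, integral_sub, integral_const_mul, integral_mul_const,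
      integral_const]
    · simp [a, b, c]
    · exact hFG
    · exact hF.mul_const _
    · exact hFG.sub (hF.mul_const _)
    · exact hG.const_mul _
    · exact (hFG.sub (hF.mul_const _)).sub (hG.const_mul _)
    · exact integrable_const _
  have h3 : 0 ≤ c - a * b - a * b + c := h2 ▸ integral_nonneg h1
  linarith

theorem integrable_of_mem_Icc {f : X → ℝ} (hf : Measurable f)
    (h : ∀ x, f x ∈ Set.Icc (0 : ℝ) 1) : Integrable f μ :=
  Integrable.of_bound hf.aestronglyMeasurable 1
    (Filter.Eventually.of_forall fun x => by
      rw [Real.norm_of_nonneg (h x).1]; exact (h x).2)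

/-- Functions on a product of copies of `X` that increase with the values of `r` at the
coordinates. -/
def MonotoneAlong {ι : Type*} (r : X → ℝ) (f : (ι → X) → ℝ) : Prop :=
  ∀ x y, (∀ i, r (x i) ≤ r (y i)) → f x ≤ f y

/-- Induction on the number of coordinates. With the first coordinate fixed, the induction
hypothesis bounds the integral of the product from below by the product of the partial integrals.
These increase with `r` of the first coordinate, so Chebyshev's inequality applies to them. -/
theorem harris_fin (r : X → ℝ) (n : ℕ) : ∀ f g : (Fin n → X) → ℝ, Measurable f → Measurable g →
    (∀ x, f x ∈ Set.Icc (0 : ℝ) 1) → (∀ x, g x ∈ Set.Icc (0 : ℝ) 1) →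
    MonotoneAlong r f → MonotoneAlong r g →
    (∫ x, f x ∂Measure.pi fun _ => μ) * ∫ x, g x ∂Measure.pi (fun _ => μ)
      ≤ ∫ x, f x * g x ∂Measure.pi fun _ => μ := by
  induction n with
  | zero =>
    intro f g hf hg hf1 hg1 hfm hgm
    have hc : ∀ h : (Fin 0 → X) → ℝ, ∫ x, h x ∂(Measure.pi fun _ => μ) = h default := by
      intro h
      rw [integral_congr_ae (g := fun _ => h default)
        (Filter.Eventually.of_forall fun x => congrArg h (Subsingleton.elim _ _))]
      simp
    rw [hc, hc, hc]
  | succ n ih =>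
    intro f g hf hg hf1 hg1 hfm hgm
    have key : ∀ h : (Fin (n + 1) → X) → ℝ, Measurable h → (∀ x, h x ∈ Set.Icc (0 : ℝ) 1) →
        ∫ x, h x ∂(Measure.pi fun _ => μ)
          = ∫ a, ∫ z, h (Fin.cons a z) ∂(Measure.pi fun _ => μ) ∂μ := by
      intro h hh hh1
      have mp := (measurePreserving_piFinSuccAbove (fun _ : Fin (n + 1) => μ) 0).symm
      rw [← mp.integral_comp', integral_prod]
      · simp [MeasurableEquiv.piFinSuccAbove]
        rfl
      · refine integrable_of_mem_Icc (hh.comp (MeasurableEquiv.measurable _)) fun x => hh1 _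
    have hcons : Measurable fun p : X × (Fin n → X) => (Fin.cons p.1 p.2 : Fin (n + 1) → X) := by
      rw [measurable_pi_iff]
      intro i
      refine Fin.cases ?_ (fun j => ?_) i
      · simpa using measurable_fst
      · simp only [Fin.cons_succ]
        exact (measurable_pi_apply j).comp measurable_snd
    have hfg1 : ∀ x, f x * g x ∈ Set.Icc (0 : ℝ) 1 := fun x =>
      ⟨mul_nonneg (hf1 x).1 (hg1 x).1, mul_le_one₀ (hf1 x).2 (hg1 x).1 (hg1 x).2⟩
    have hm : ∀ h : (Fin (n + 1) → X) → ℝ, Measurable h →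
        Measurable fun a => ∫ z, h (Fin.cons a z) ∂(Measure.pi fun _ : Fin n => μ) := by
      intro h hh
      exact ((hh.comp hcons).stronglyMeasurable.integral_prod_right').measurable
    have hs : ∀ h : (Fin (n + 1) → X) → ℝ, Measurable h → ∀ a : X,
        Measurable fun z : Fin n → X => h (Fin.cons a z) := fun h hh a =>
      (hh.comp hcons).comp measurable_prodMk_left
    have hI : ∀ h : (Fin (n + 1) → X) → ℝ, (∀ x, h x ∈ Set.Icc (0 : ℝ) 1) → ∀ a,
        (∫ z, h (Fin.cons a z) ∂(Measure.pi fun _ : Fin n => μ)) ∈ Set.Icc (0 : ℝ) 1 := by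
      intro h hh a
      refine ⟨integral_nonneg fun z => (hh _).1, ?_⟩
      have := integral_mono_of_nonneg (μ := Measure.pi fun _ : Fin n => μ)
        (Filter.Eventually.of_forall fun z => (hh (Fin.cons a z)).1)
        (integrable_const (1 : ℝ)) (Filter.Eventually.of_forall fun z => (hh (Fin.cons a z)).2)
      simpa using this
    have hmono : ∀ h : (Fin (n + 1) → X) → ℝ, Measurable h → (∀ x, h x ∈ Set.Icc (0 : ℝ) 1) →
        MonotoneAlong r h → ∀ a b, r a ≤ r b →
        ∫ z, h (Fin.cons a z) ∂(Measure.pi fun _ : Fin n => μ)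
          ≤ ∫ z, h (Fin.cons b z) ∂(Measure.pi fun _ : Fin n => μ) := by
      intro h hh hh1 hr a b hab
      refine integral_mono (integrable_of_mem_Icc (hs h hh a) fun _ => hh1 _)
        (integrable_of_mem_Icc (hs h hh b) fun _ => hh1 _) fun z => hr _ _ fun i => ?_
      refine Fin.cases ?_ (fun j => ?_) i
      · simpa using hab
      · simp
    rw [key f hf hf1, key g hg hg1, key (fun x => f x * g x) (hf.mul hg) hfg1]
    refine le_trans (integral_mul_integral_le_of_monovary
      (integrable_of_mem_Icc (hm f hf) (hI f hf1)) (integrable_of_mem_Icc (hm g hg) (hI g hg1))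
      (integrable_of_mem_Icc ((hm f hf).mul (hm g hg)) fun a =>
        ⟨mul_nonneg (hI f hf1 a).1 (hI g hg1 a).1,
          mul_le_one₀ (hI f hf1 a).2 (hI g hg1 a).1 (hI g hg1 a).2⟩) ?_) ?_
    · intro a b
      rcases le_total (r a) (r b) with hab | hab
      · exact mul_nonneg_of_nonpos_of_nonpos (sub_nonpos.2 (hmono f hf hf1 hfm a b hab))
          (sub_nonpos.2 (hmono g hg hg1 hgm a b hab))
      · exact mul_nonneg (sub_nonneg.2 (hmono f hf hf1 hfm b a hab))
          (sub_nonneg.2 (hmono g hg hg1 hgm b a hab))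
    · refine integral_mono
        (integrable_of_mem_Icc ((hm f hf).mul (hm g hg)) fun a =>
          ⟨mul_nonneg (hI f hf1 a).1 (hI g hg1 a).1,
            mul_le_one₀ (hI f hf1 a).2 (hI g hg1 a).1 (hI g hg1 a).2⟩)
        (integrable_of_mem_Icc (hm _ (hf.mul hg)) (hI (fun x => f x * g x) hfg1)) fun a => ?_
      refine ih _ _ (hs f hf a) (hs g hg a) (fun _ => hf1 _) (fun _ => hg1 _) ?_ ?_
      · intro x y hxy
        refine hfm _ _ fun i => ?_
        refine Fin.cases ?_ (fun j => ?_) i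
        · simp
        · simpa using hxy j
      · intro x y hxy
        refine hgm _ _ fun i => ?_
        refine Fin.cases ?_ (fun j => ?_) i
        · simp
        · simpa using hxy j

/-- Harris' inequality: events that are increasing along `r` are positively correlated under a
product measure. -/
theorem harris {ι : Type*} [Fintype ι] (r : X → ℝ) {s t : Set (ι → X)} (hs : MeasurableSet s)
    (ht : MeasurableSet t) (hsr : ∀ x y, (∀ i, r (x i) ≤ r (y i)) → x ∈ s → y ∈ s)
    (htr : ∀ x y, (∀ i, r (x i) ≤ r (y i)) → x ∈ t → y ∈ t) :
    (Measure.pi fun _ => μ).real s * (Measure.pi fun _ => μ).real t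
      ≤ (Measure.pi fun _ => μ).real (s ∩ t) := by
  classical
  let e := (Fintype.equivFin ι).symm
  have mp := measurePreserving_piCongrLeft (fun _ : ι => μ) e
  have hval : ∀ (x : Fin (Fintype.card ι) → X) (i : ι),
      MeasurableEquiv.piCongrLeft (fun _ => X) e x i = x (e.symm i) := by
    intro x i
    obtain ⟨j, rfl⟩ := e.surjective i
    rw [MeasurableEquiv.coe_piCongrLeft, Equiv.piCongrLeft_apply_apply, Equiv.symm_apply_apply]
  set T := MeasurableEquiv.piCongrLeft (fun _ : ι => X) e
  have hreal : ∀ u : Set (ι → X), MeasurableSet u → (Measure.pi fun _ => μ).real u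
      = ∫ x, (T ⁻¹' u).indicator (fun _ => (1 : ℝ)) x ∂Measure.pi fun _ => μ := by
    intro u hu
    rw [integral_indicator (T.measurable hu), setIntegral_const, smul_eq_mul, mul_one, measureReal_def,
      measureReal_def, mp.measure_preimage hu.nullMeasurableSet]
  have hind : ∀ (u : Set (ι → X)) (x : Fin (Fintype.card ι) → X),
      (T ⁻¹' u).indicator (fun _ => (1 : ℝ)) x ∈ Set.Icc (0 : ℝ) 1 := by
    intro u x
    by_cases h : x ∈ T ⁻¹' u <;> simp [h]
  have hmon : ∀ u : Set (ι → X), (∀ x y, (∀ i, r (x i) ≤ r (y i)) → x ∈ u → y ∈ u) →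
      MonotoneAlong r ((T ⁻¹' u).indicator fun _ => (1 : ℝ)) := by
    intro u hu x y hxy
    by_cases h : x ∈ T ⁻¹' u
    · have h' : y ∈ T ⁻¹' u := hu (T x) (T y) (fun i => by rw [hval, hval]; exact hxy _) h
      simp [h, h']
    · rw [Set.indicator_of_notMem h]
      exact (hind u y).1
  have hm : ∀ u : Set (ι → X), MeasurableSet u →
      Measurable ((T ⁻¹' u).indicator fun _ => (1 : ℝ)) := fun u hu =>
    measurable_const.indicator (T.measurable hu)
  rw [hreal s hs, hreal t ht, hreal _ (hs.inter ht)]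
  refine le_trans (harris_fin r _ _ _ (hm s hs) (hm t ht) (hind s) (hind t) (hmon s hsr)
    (hmon t htr)) (le_of_eq ?_)
  congr 1 with x
  by_cases h : T x ∈ s <;> by_cases h' : T x ∈ t <;> simp [Set.indicator, h, h']

/-- If an event is covered by increasing events of small probability, then two of them occur
together with probability at least `3/16` times the square of the probability of the event. -/
theorem three_sixteenths_le {ι κ : Type*} [Fintype ι] [Finite κ] (r : X → ℝ)
    (F : κ → Set (ι → X)) (hF : ∀ k, MeasurableSet (F k))
    (hFr : ∀ k x y, (∀ i, r (x i) ≤ r (y i)) → x ∈ F k → y ∈ F k)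
    (hsmall : ∀ k, (Measure.pi fun _ => μ).real (F k)
      ≤ (Measure.pi fun _ => μ).real (⋃ k, F k) / 8) :
    3 / 16 * (Measure.pi fun _ => μ).real (⋃ k, F k) ^ 2
      ≤ (Measure.pi fun _ => μ).real {x | ∃ k l, k ≠ l ∧ x ∈ F k ∧ x ∈ F l} := by
  classical
  have := Fintype.ofFinite κ
  set ν : Measure (ι → X) := Measure.pi fun _ => μ
  set P := ν.real (⋃ k, F k)
  rcases (measureReal_nonneg : 0 ≤ P).eq_or_lt with hP | hP
  · rw [show P = 0 from hP.symm]; simp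
  -- A maximal subfamily whose union has probability at most `P / 2`: one more event, of probability
  -- at most `P / 8`, would exceed `P / 2`, whence the lower bound `3P/8`. The complementary
  -- subfamily must account for the remaining `P / 2`.
  obtain ⟨T, hT⟩ := (Set.toFinite
    {T : Finset κ | ν.real (⋃ k ∈ T, F k) ≤ P / 2}).exists_maximal
    ⟨∅, by simpa using (half_pos hP).le⟩
  have hT' : ν.real (⋃ k ∈ T, F k) ≤ P / 2 := hT.prop
  have hex : ∃ k, k ∉ T := by
    by_contra! h
    have : (⋃ k ∈ T, F k) = ⋃ k, F k := by simp [h]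
    rw [this] at hT'
    change P ≤ P / 2 at hT'
    have : 0 < P := hP
    linarith
  obtain ⟨k, hk⟩ := hex
  have h1 : P / 2 < ν.real (⋃ l ∈ insert k T, F l) := by
    by_contra! h
    exact hk (hT.le_of_ge h (Finset.subset_insert k T) (Finset.mem_insert_self k T))
  have h2 : ν.real (⋃ l ∈ insert k T, F l) ≤ ν.real (F k) + ν.real (⋃ l ∈ T, F l) := by
    rw [Finset.set_biUnion_insert]
    exact measureReal_union_le _ _
  have h3 : 3 / 8 * P ≤ ν.real (⋃ l ∈ T, F l) := by
    have := hsmall k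
    change _ ≤ P / 8 at this
    linarith
  have h4 : P / 2 ≤ ν.real (⋃ l ∈ Tᶜ, F l) := by
    have : P ≤ ν.real (⋃ l ∈ T, F l) + ν.real (⋃ l ∈ Tᶜ, F l) := by
      refine le_trans (measureReal_mono ?_) (measureReal_union_le _ _)
      intro x hx
      obtain ⟨l, hl⟩ := Set.mem_iUnion.1 hx
      by_cases h : l ∈ T
      · exact Or.inl (Set.mem_biUnion h hl)
      · exact Or.inr (Set.mem_biUnion (Finset.mem_compl.2 h) hl)
    linarith
  have hmeas : ∀ S : Finset κ, MeasurableSet (⋃ l ∈ S, F l) := fun S =>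
    Finset.measurableSet_biUnion S fun l _ => hF l
  have hup : ∀ (S : Finset κ) (x y : ι → X), (∀ i, r (x i) ≤ r (y i)) →
      x ∈ (⋃ l ∈ S, F l) → y ∈ ⋃ l ∈ S, F l := by
    intro S x y hxy hx
    simp only [Set.mem_iUnion] at hx ⊢
    obtain ⟨l, hl, hx⟩ := hx
    exact ⟨l, hl, hFr l x y hxy hx⟩
  calc 3 / 16 * P ^ 2 = (3 / 8 * P) * (P / 2) := by ring
    _ ≤ ν.real (⋃ l ∈ T, F l) * ν.real (⋃ l ∈ Tᶜ, F l) := by gcongr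
    _ ≤ ν.real ((⋃ l ∈ T, F l) ∩ ⋃ l ∈ Tᶜ, F l) :=
      harris r (hmeas _) (hmeas _) (hup _) (hup _)
    _ ≤ _ := by
      refine measureReal_mono ?_
      rintro x ⟨hx, hx'⟩
      simp only [Set.mem_iUnion] at hx hx'
      obtain ⟨a, ha, hxa⟩ := hx
      obtain ⟨b, hb, hxb⟩ := hx'
      exact ⟨a, b, fun hab => Finset.mem_compl.1 hb (hab ▸ ha), hxa, hxb⟩

end Harris

/-! ### One-step bounds for the Bhattacharyya parameter. -/

/-- This is the triangle inequality for the integral of the complex function `f + i g`. -/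
theorem sqrt_sq_integral_add_le {X : Type*} [MeasurableSpace X] {μ : Measure X} {f g : X → ℝ}
    (hf : Integrable f μ) (hg : Integrable g μ) :
    √((∫ x, f x ∂μ) ^ 2 + (∫ x, g x ∂μ) ^ 2) ≤ ∫ x, √(f x ^ 2 + g x ^ 2) ∂μ := by
  have h := norm_integral_le_integral_norm (μ := μ) fun x => (f x : ℂ) + (g x : ℂ) * Complex.I
  rw [integral_add hf.ofReal (hg.ofReal.mul_const _), integral_mul_const] at h
  simpa only [integral_complex_ofReal, Complex.norm_add_mul_I] using h

theorem sum_zmod_two (f : ZMod 2 → ℝ) : ∑ v, f v = f 0 + f 1 := Fin.sum_univ_two f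

namespace Channel

variable (W : Channel.{u})

/-- The integrand of the Bhattacharyya parameter. -/
noncomputable def geomDensity (y : W.Out) : ℝ := √(W.p 0 y * W.p 1 y)

/-- The output density for a uniform input. -/
noncomputable def meanDensity (y : W.Out) : ℝ := (W.p 0 y + W.p 1 y) / 2

theorem geomDensity_nonneg (y : W.Out) : 0 ≤ W.geomDensity y := Real.sqrt_nonneg _

theorem geomDensity_sq (y : W.Out) : W.geomDensity y ^ 2 = W.p 0 y * W.p 1 y :=
  Real.sq_sqrt (mul_nonneg (W.p_nonneg _ _) (W.p_nonneg _ _))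

theorem meanDensity_nonneg (y : W.Out) : 0 ≤ W.meanDensity y :=
  div_nonneg (add_nonneg (W.p_nonneg _ _) (W.p_nonneg _ _)) zero_le_two

theorem geomDensity_le_meanDensity (y : W.Out) : W.geomDensity y ≤ W.meanDensity y := by
  refine Real.sqrt_le_iff.2 ⟨W.meanDensity_nonneg y, ?_⟩
  unfold meanDensity
  nlinarith [sq_nonneg (W.p 0 y - W.p 1 y)]

theorem geomDensity_measurable : Measurable W.geomDensity :=
  ((W.p_measurable 0).mul (W.p_measurable 1)).sqrt

theorem meanDensity_integrable : Integrable W.meanDensity W.ref :=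
  ((W.p_integrable 0).add (W.p_integrable 1)).div_const 2

theorem geomDensity_integrable : Integrable W.geomDensity W.ref :=
  W.meanDensity_integrable.mono' W.geomDensity_measurable.aestronglyMeasurable
    (Filter.Eventually.of_forall fun y => by
      rw [Real.norm_of_nonneg (W.geomDensity_nonneg y)]
      exact W.geomDensity_le_meanDensity y)

theorem integral_meanDensity : ∫ y, W.meanDensity y ∂W.ref = 1 := by
  unfold meanDensity
  rw [integral_div, integral_add (W.p_integrable 0) (W.p_integrable 1), W.p_integral,
    W.p_integral]
  norm_num

theorem integral_geomDensity : ∫ y, W.geomDensity y ∂W.ref = W.bhattacharyya := rfl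

theorem bhattacharyya_nonneg : 0 ≤ W.bhattacharyya := integral_nonneg W.geomDensity_nonneg

theorem bhattacharyya_le_one : W.bhattacharyya ≤ 1 := by
  rw [← W.integral_meanDensity, ← W.integral_geomDensity]
  exact integral_mono W.geomDensity_integrable W.meanDensity_integrable
    W.geomDensity_le_meanDensity

theorem bhattacharyya_plus : W.plus.bhattacharyya = W.bhattacharyya ^ 2 := by
  have h : ∀ y : (W.Out × W.Out) × ZMod 2, √(W.plusDensity 0 y * W.plusDensity 1 y)
      = (W.geomDensity y.1.1 * W.geomDensity y.1.2) * 2⁻¹ := by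
    rintro ⟨⟨a, b⟩, c⟩
    have e1 := W.geomDensity_sq a
    have e2 := W.geomDensity_sq b
    have e : W.p (c + 0) a * W.p (c + 1) a = W.p 0 a * W.p 1 a := by
      fin_cases c
      · rfl
      · exact mul_comm _ _
    have e3 : W.plusDensity 0 ((a, b), c) * W.plusDensity 1 ((a, b), c)
        = (W.geomDensity a * W.geomDensity b * 2⁻¹) ^ 2 := by
      rw [mul_pow, mul_pow, e1, e2, ← e]
      simp only [plusDensity]
      ring
    rw [e3, Real.sqrt_sq (mul_nonneg (mul_nonneg (W.geomDensity_nonneg _)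
      (W.geomDensity_nonneg _)) (by norm_num))]
  change ∫ y, √(W.plusDensity 0 y * W.plusDensity 1 y)
    ∂((W.ref.prod W.ref).prod Measure.count) = _
  simp only [h]
  rw [integral_prod_mul (fun z : W.Out × W.Out => W.geomDensity z.1 * W.geomDensity z.2)
      (fun _ : ZMod 2 => (2⁻¹ : ℝ)), integral_prod_mul, integral_geomDensity]
  have : ∫ _ : ZMod 2, (2⁻¹ : ℝ) ∂Measure.count = 1 := by
    simp [integral_fintype, Integrable.of_finite, ZMod.card]
  rw [this]
  ring

/-- As `geomDensity ≤ meanDensity`, this is a sum of two squares. Its root is bounded above by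
comparing squares and below by the triangle inequality in the plane. -/
theorem minusDensity_mul (y : W.Out × W.Out) :
    W.minusDensity 0 y * W.minusDensity 1 y
      = (W.geomDensity y.1 * W.meanDensity y.2) ^ 2
        + W.geomDensity y.2 ^ 2 * (W.meanDensity y.1 ^ 2 - W.geomDensity y.1 ^ 2) := by
  have h : ∀ u, W.minusDensity u y
      = 2⁻¹ * (W.p u y.1 * W.p 0 y.2) + 2⁻¹ * (W.p (u + 1) y.1 * W.p 1 y.2) := by
    intro u
    rw [minusDensity, sum_zmod_two, add_zero]
  rw [h, h, mul_pow, W.geomDensity_sq, W.geomDensity_sq]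
  have e : W.p (0 + 1) = W.p 1 := congrArg W.p (zero_add 1)
  have e' : W.p (1 + 1) = W.p 0 := rfl
  rw [e, e']
  unfold meanDensity
  ring

theorem sqrt_minusDensity_integrable :
    Integrable (fun y => √(W.minusDensity 0 y * W.minusDensity 1 y)) (W.ref.prod W.ref) :=
  W.minus.geomDensity_integrable

/-- `Z(W⁻) ≤ 2 Z(W) - Z(W)²`. -/
theorem one_sub_bhattacharyya_minus_ge :
    (1 - W.bhattacharyya) ^ 2 ≤ 1 - W.minus.bhattacharyya := by
  have h : ∀ y : W.Out × W.Out, √(W.minusDensity 0 y * W.minusDensity 1 y)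
      ≤ W.meanDensity y.1 * W.geomDensity y.2 + W.geomDensity y.1 * W.meanDensity y.2
        - W.geomDensity y.1 * W.geomDensity y.2 := by
    rintro ⟨a, b⟩
    have ha := W.geomDensity_nonneg a
    have hb := W.geomDensity_nonneg b
    have ha' := sub_nonneg.2 (W.geomDensity_le_meanDensity a)
    have hb' := sub_nonneg.2 (W.geomDensity_le_meanDensity b)
    refine Real.sqrt_le_iff.2 ⟨?_, ?_⟩
    · have := mul_nonneg ha' hb
      have := mul_nonneg ha (W.meanDensity_nonneg b)
      dsimp only
      linarith
    · rw [minusDensity_mul]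
      -- The difference of the two squares is exactly twice this product.
      have := mul_nonneg (mul_nonneg ha hb) (mul_nonneg ha' hb')
      dsimp only
      nlinarith
  have i1 := W.meanDensity_integrable.mul_prod W.geomDensity_integrable
  have i2 := W.geomDensity_integrable.mul_prod W.meanDensity_integrable
  have i3 := W.geomDensity_integrable.mul_prod W.geomDensity_integrable
  have key := integral_mono W.sqrt_minusDensity_integrable ((i1.add i2).sub i3) h
  have e : ∫ y : W.Out × W.Out, (W.meanDensity y.1 * W.geomDensity y.2
      + W.geomDensity y.1 * W.meanDensity y.2 - W.geomDensity y.1 * W.geomDensity y.2)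
      ∂(W.ref.prod W.ref) = W.bhattacharyya + W.bhattacharyya - W.bhattacharyya ^ 2 := by
    rw [integral_sub (by exact i1.add i2) i3, integral_add i1 i2, integral_prod_mul, integral_prod_mul,
      integral_prod_mul, integral_meanDensity, integral_geomDensity]
    ring
  have key' : W.minus.bhattacharyya
      ≤ W.bhattacharyya + W.bhattacharyya - W.bhattacharyya ^ 2 := e ▸ key
  linarith

/-- `Z(W⁻) ≥ Z(W) √(2 - Z(W)²)`. -/
theorem one_sub_sq_bhattacharyya_minus_le :
    1 - W.minus.bhattacharyya ^ 2 ≤ (1 - W.bhattacharyya ^ 2) ^ 2 := by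
  set Z := W.bhattacharyya
  have hZ0 : 0 ≤ Z := W.bhattacharyya_nonneg
  have hZ1 : 0 ≤ 1 - Z ^ 2 := sub_nonneg.2 (pow_le_one₀ hZ0 W.bhattacharyya_le_one)
  -- The triangle inequality in the second output, with the result regrouped as a sum of squares so
  -- that it applies once more to the first output.
  have inner : ∀ a, √((W.geomDensity a * √(1 - Z ^ 2)) ^ 2 + (W.meanDensity a * Z) ^ 2)
      ≤ ∫ b, √(W.minusDensity 0 (a, b) * W.minusDensity 1 (a, b)) ∂W.ref := by
    intro a
    have hd : 0 ≤ W.meanDensity a ^ 2 - W.geomDensity a ^ 2 :=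
      sub_nonneg.2 (pow_le_pow_left₀ (W.geomDensity_nonneg a) (W.geomDensity_le_meanDensity a) 2)
    have := sqrt_sq_integral_add_le (W.meanDensity_integrable.const_mul (W.geomDensity a))
      (W.geomDensity_integrable.mul_const √(W.meanDensity a ^ 2 - W.geomDensity a ^ 2))
    rw [integral_const_mul, integral_mul_const, integral_meanDensity, integral_geomDensity,
      mul_pow W.bhattacharyya, Real.sq_sqrt hd] at this
    refine le_trans (le_of_eq ?_) (this.trans (le_of_eq ?_))
    · rw [mul_pow, Real.sq_sqrt hZ1]
      congr 1
      ring
    · congr 1 with b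
      rw [mul_pow _ √_, Real.sq_sqrt hd, minusDensity_mul]
  -- The radicand equals `1 - (1 - Z ^ 2) ^ 2`.
  have outer : √(Z ^ 2 * (1 - Z ^ 2) + Z ^ 2) ≤ W.minus.bhattacharyya := by
    have h1 := sqrt_sq_integral_add_le (W.geomDensity_integrable.mul_const √(1 - Z ^ 2))
      (W.meanDensity_integrable.mul_const Z)
    rw [integral_mul_const, integral_mul_const, integral_meanDensity, integral_geomDensity,
      mul_pow W.bhattacharyya, Real.sq_sqrt hZ1, one_mul] at h1
    refine h1.trans ?_
    have e : W.minus.bhattacharyya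
        = ∫ a, ∫ b, √(W.minusDensity 0 (a, b) * W.minusDensity 1 (a, b)) ∂W.ref ∂W.ref :=
      integral_prod _ W.sqrt_minusDensity_integrable
    rw [e]
    exact integral_mono_of_nonneg (Filter.Eventually.of_forall fun _ => Real.sqrt_nonneg _)
      W.sqrt_minusDensity_integrable.integral_prod_left (Filter.Eventually.of_forall inner)
  have h2 := (Real.sqrt_le_left W.minus.bhattacharyya_nonneg).1 outer
  nlinarith

/-! ### Bounds for synthetic channels in terms of the index weight. -/

/-- The Hamming weight of an index, i.e. the number of `W ↦ W⁺` steps. -/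
def _root_.PolarList.indexWeight {n : ℕ} (b : Fin n → Fin 2) : ℕ := ∑ t, (b t : ℕ)

theorem _root_.PolarList.indexWeight_succ {n : ℕ} (b : Fin (n + 1) → Fin 2) :
    indexWeight b = (b 0 : ℕ) + indexWeight fun t => b t.succ :=
  Fin.sum_univ_succ _

theorem _root_.PolarList.indexWeight_le {n : ℕ} (b : Fin n → Fin 2) : indexWeight b ≤ n := by
  refine (Finset.sum_le_card_nsmul _ _ 1 fun t _ => Nat.lt_succ_iff.1 (b t).2).trans ?_
  simp

/-- A minus step at worst squares `1 - Z`, and a plus step does not decrease it; only the number of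
minus steps matters. -/
theorem one_sub_bhattacharyya_synthetic_ge (n : ℕ) : ∀ (W : Channel.{u}) (b : Fin n → Fin 2),
    (1 - W.bhattacharyya) ^ 2 ^ (n - indexWeight b) ≤ 1 - (W.synthetic n b).bhattacharyya := by
  induction n with
  | zero => intro W b; simp [synthetic]
  | succ n ih =>
    intro W b
    have hb := indexWeight_le fun t => b t.succ
    have h0 : 0 ≤ 1 - W.bhattacharyya := sub_nonneg.2 W.bhattacharyya_le_one
    rw [synthetic, indexWeight_succ]
    refine le_trans ?_ (ih _ _)
    rcases Fin.exists_fin_two.1 ⟨b 0, rfl⟩ with h | h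
    · simp only [h, if_true, Fin.val_zero]
      rw [show n + 1 - (0 + indexWeight fun t => b t.succ)
        = (n - indexWeight fun t => b t.succ) + 1 by omega, pow_succ', pow_mul]
      exact pow_le_pow_left₀ (sq_nonneg _) W.one_sub_bhattacharyya_minus_ge _
    · simp only [h, one_ne_zero, if_false, Fin.val_one, bhattacharyya_plus]
      rw [show n + 1 - (1 + indexWeight fun t => b t.succ)
        = n - indexWeight fun t => b t.succ by omega]
      refine pow_le_pow_left₀ h0 ?_ _
      nlinarith [W.bhattacharyya_nonneg, W.bhattacharyya_le_one]

/-- The hypothesis says `y ≥ x (2 - x)`, and Bernoulli's inequality, used twice, gives `(2 - x)^k ≥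
1 + k (1 - x) ≥ 2 - x^k`. This is what allows a minus step to be moved behind later plus steps. -/
theorem _root_.PolarList.one_sub_pow_le_sq {x y : ℝ} (hx0 : 0 ≤ x) (hx1 : x ≤ 1)
    (h : 1 - y ≤ (1 - x) ^ 2) (k : ℕ) : 1 - y ^ k ≤ (1 - x ^ k) ^ 2 := by
  have h1 : 0 ≤ 1 - x := sub_nonneg.2 hx1
  have h2 : x * (2 - x) ≤ y := by nlinarith
  have h3 : (x * (2 - x)) ^ k ≤ y ^ k := pow_le_pow_left₀ (by nlinarith) h2 k
  have h4 : 1 + (k : ℝ) * (1 - x) ≤ (2 - x) ^ k := by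
    have := one_add_mul_le_pow (a := 1 - x) (by linarith) k
    rwa [show 1 + (1 - x) = 2 - x by ring] at this
  have h5 : 1 - x ^ k ≤ k * (1 - x) := by
    have := one_add_mul_le_pow (a := x - 1) (by linarith) k
    rw [show 1 + (x - 1) = x by ring] at this
    linarith
  rw [mul_pow] at h3
  nlinarith [mul_le_mul_of_nonneg_left (show 2 - x ^ k ≤ (2 - x) ^ k by linarith)
    (pow_nonneg hx0 k)]

/-- The bound is the one obtained when all plus steps precede all minus steps; `one_sub_pow_le_sq`
shows that it holds for every order. Working with `Z²` makes the minus step a plain squaring of `1 -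
Z²`. -/
theorem one_sub_sq_bhattacharyya_synthetic_le (n : ℕ) :
    ∀ (W : Channel.{u}) (b : Fin n → Fin 2),
    1 - (W.synthetic n b).bhattacharyya ^ 2
      ≤ (1 - (W.bhattacharyya ^ 2) ^ 2 ^ indexWeight b) ^ 2 ^ (n - indexWeight b) := by
  induction n with
  | zero => intro W b; simp [synthetic, indexWeight]
  | succ n ih =>
    intro W b
    have hb := indexWeight_le fun t => b t.succ
    have h0 := W.bhattacharyya_nonneg
    have h1 := W.bhattacharyya_le_one
    rw [synthetic, indexWeight_succ]
    refine le_trans (ih _ _) ?_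
    rcases Fin.exists_fin_two.1 ⟨b 0, rfl⟩ with h | h
    · simp only [h, if_true, Fin.val_zero, zero_add]
      rw [show n + 1 - (indexWeight fun t => b t.succ)
        = (n - indexWeight fun t => b t.succ) + 1 by omega, pow_succ' 2 (n - _), pow_mul]
      refine pow_le_pow_left₀ ?_ (one_sub_pow_le_sq (sq_nonneg _) (pow_le_one₀ h0 h1)
        W.one_sub_sq_bhattacharyya_minus_le _) _
      exact sub_nonneg.2 (pow_le_one₀ (sq_nonneg _)
        (pow_le_one₀ W.minus.bhattacharyya_nonneg W.minus.bhattacharyya_le_one))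
    · simp only [h, one_ne_zero, if_false, Fin.val_one, bhattacharyya_plus]
      rw [show n + 1 - (1 + indexWeight fun t => b t.succ)
        = n - indexWeight fun t => b t.succ by omega, pow_add 2 1, pow_one, pow_mul _ 2]

end Channel

/-! ### Minimum distance of codes spanned by rows of the polar matrix. -/

theorem sum_cons {M : Type*} [AddCommMonoid M] {n : ℕ} (f : (Fin (n + 1) → Fin 2) → M) :
    ∑ i, f i = ∑ i : Fin n → Fin 2, f (Fin.cons 0 i) + ∑ i : Fin n → Fin 2, f (Fin.cons 1 i) := by
  rw [← (Fin.consEquiv fun _ : Fin (n + 1) => Fin 2).sum_comp, Fintype.sum_prod_type,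
    Fin.sum_univ_two]
  rfl

theorem polarMatrix_cons {n : ℕ} (a b : Fin 2) (i j : Fin n → Fin 2) :
    polarMatrix (n + 1) (Fin.cons a i) (Fin.cons b j) = polarKernel a b * polarMatrix n i j := by
  simp [polarMatrix, Fin.prod_univ_succ]

/-- The Plotkin `(u + v | v)` structure of the polar transform. -/
theorem hammingNorm_vecMul_polarMatrix_succ {n : ℕ} (u : (Fin (n + 1) → Fin 2) → ZMod 2) :
    hammingNorm (Matrix.vecMul u (polarMatrix (n + 1)))
      = hammingNorm (Matrix.vecMul ((fun i => u (Fin.cons 0 i)) + fun i => u (Fin.cons 1 i))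
          (polarMatrix n))
        + hammingNorm (Matrix.vecMul (fun i => u (Fin.cons 1 i)) (polarMatrix n)) := by
  have h0 : ∀ j, Matrix.vecMul u (polarMatrix (n + 1)) (Fin.cons 0 j)
      = Matrix.vecMul ((fun i => u (Fin.cons 0 i)) + fun i => u (Fin.cons 1 i))
          (polarMatrix n) j := by
    intro j
    simp [Matrix.vecMul, dotProduct, sum_cons, polarMatrix_cons, polarKernel, add_mul,
      Finset.sum_add_distrib]
  have h1 : ∀ j, Matrix.vecMul u (polarMatrix (n + 1)) (Fin.cons 1 j)
      = Matrix.vecMul (fun i => u (Fin.cons 1 i)) (polarMatrix n) j := by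
    intro j
    simp [Matrix.vecMul, dotProduct, sum_cons, polarMatrix_cons, polarKernel]
  simp only [hammingNorm, Finset.card_filter]
  rw [sum_cons]
  simp only [h0, h1]

/-- The minimum distance of a code generated by rows of `F^{⊗n}` is that of its lightest row. -/
theorem two_pow_le_hammingNorm_vecMul (n : ℕ) : ∀ (u : (Fin n → Fin 2) → ZMod 2) (w : ℕ),
    u ≠ 0 → (∀ i, u i ≠ 0 → w ≤ indexWeight i) →
    2 ^ w ≤ hammingNorm (Matrix.vecMul u (polarMatrix n)) := by
  induction n with
  | zero =>
    intro u w hu hw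
    obtain ⟨i, hi⟩ := Function.ne_iff.1 hu
    have h0 : w = 0 := by simpa [indexWeight] using hw i hi
    have : Matrix.vecMul u (polarMatrix 0) = u := by
      ext j
      simp [Matrix.vecMul, dotProduct, polarMatrix]
      exact congrArg u (Subsingleton.elim _ _)
    rw [this, h0, pow_zero]
    exact hammingNorm_pos_iff.2 hu
  | succ n ih =>
    intro u w hu hw
    rw [hammingNorm_vecMul_polarMatrix_succ]
    set a : (Fin n → Fin 2) → ZMod 2 := fun i => u (Fin.cons 0 i)
    set b : (Fin n → Fin 2) → ZMod 2 := fun i => u (Fin.cons 1 i)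
    have ha : ∀ i, a i ≠ 0 → w ≤ indexWeight i := fun i hi => by
      simpa [indexWeight_succ] using hw _ hi
    have hb : ∀ i, b i ≠ 0 → w ≤ indexWeight i + 1 := fun i hi => by
      simpa [indexWeight_succ, add_comm] using hw _ hi
    by_cases hb0 : b = 0
    · have ha0 : a ≠ 0 := by
        intro ha0
        refine hu (funext fun i => ?_)
        rw [← Fin.cons_self_tail i]
        rcases Fin.exists_fin_two.1 ⟨i 0, rfl⟩ with h | h
        · rw [h]; exact congrFun ha0 _
        · rw [h]; exact congrFun hb0 _
      rw [hb0, add_zero]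
      exact (ih a w ha0 ha).trans (Nat.le_add_right _ _)
    -- If the first half vanishes then `a = b`, so `b` inherits the full bound `w` from `a`.
    -- Otherwise both halves are nonzero and each contributes `2 ^ (w - 1)`; the truncation at `w =
    -- 0` is harmless, as only `w ≤ (w - 1) + 1` is needed.
    · by_cases hab : a + b = 0
      · refine (ih b w hb0 fun i hi => ha i fun hai => hi ?_).trans (Nat.le_add_left _ _)
        have := congrFun hab i
        rwa [Pi.add_apply, hai, zero_add] at this
      · have h1 : 2 ^ (w - 1) ≤ hammingNorm (Matrix.vecMul (a + b) (polarMatrix n)) := by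
          refine ih _ _ hab fun i hi => ?_
          by_cases hai : a i = 0
          · rw [Pi.add_apply, hai, zero_add] at hi
            exact Nat.sub_le_iff_le_add.2 (hb i hi)
          · exact (Nat.sub_le w 1).trans (ha i hai)
        have h2 : 2 ^ (w - 1) ≤ hammingNorm (Matrix.vecMul b (polarMatrix n)) :=
          ih _ _ hb0 fun i hi => Nat.sub_le_iff_le_add.2 (hb i hi)
        refine le_trans ?_ (add_le_add h1 h2)
        rw [← two_mul, ← pow_succ']
        exact Nat.pow_le_pow_right two_pos (by omega)

theorem polarEncode_eq_vecMul {n : ℕ} (A : Finset (Fin n → Fin 2)) (u : A → ZMod 2) :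
    polarEncode A u
      = Matrix.vecMul (fun i => if h : i ∈ A then u ⟨i, h⟩ else 0) (polarMatrix n) := by
  ext j
  simp only [polarEncode, Matrix.vecMul, dotProduct, Matrix.submatrix_apply, id]
  have : ∀ i : A, u i * polarMatrix n i j
      = (fun i => (if h : i ∈ A then u ⟨i, h⟩ else 0) * polarMatrix n i j) i := fun i => by simp
  simp only [this]
  rw [Finset.sum_coe_sort A fun i => (if h : i ∈ A then u ⟨i, h⟩ else 0) * polarMatrix n i j]
  exact Finset.sum_subset (Finset.subset_univ A) fun i _ hi => by simp [hi]

theorem two_pow_le_hammingNorm_polarEncode {n w : ℕ} (A : Finset (Fin n → Fin 2))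
    (hA : ∀ i ∈ A, w ≤ indexWeight i) (u : A → ZMod 2) (hu : u ≠ 0) :
    2 ^ w ≤ hammingNorm (polarEncode A u) := by
  rw [polarEncode_eq_vecMul]
  refine two_pow_le_hammingNorm_vecMul n _ w (fun h => hu (funext fun i => ?_)) fun i hi => ?_
  · have := congrFun h i
    simpa using this
  · by_cases h : i ∈ A
    · exact hA i h
    · simp [h] at hi

theorem polarEncode_add {n : ℕ} (A : Finset (Fin n → Fin 2)) (u v : A → ZMod 2) :
    polarEncode A (u + v) = polarEncode A u + polarEncode A v :=
  Matrix.add_vecMul _ _ _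

/-! ### Unfrozen rows are heavy. -/

/-- Hoeffding's bound for the lower tail of the binomial distribution. -/
theorem card_indexWeight_le (n : ℕ) (m : ℝ) (hn : 0 < n) (hm : 2 * m ≤ n) :
    ((Finset.univ.filter fun b : Fin n → Fin 2 => (indexWeight b : ℝ) ≤ m).card : ℝ)
      ≤ 2 ^ n * Real.exp (-((n - 2 * m) ^ 2 / (2 * n))) := by
  have hn' : (0 : ℝ) < n := Nat.cast_pos.2 hn
  -- The minimiser of the Chernoff exponent `s m + n (s² / 8 - s / 2)`.
  set s : ℝ := 2 * (n - 2 * m) / n with hs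
  have hs0 : 0 ≤ s := div_nonneg (by linarith) hn'.le
  have h1 : ((Finset.univ.filter fun b : Fin n → Fin 2 => (indexWeight b : ℝ) ≤ m).card : ℝ)
      ≤ ∑ b : Fin n → Fin 2, Real.exp (s * (m - indexWeight b)) := by
    rw [Finset.card_filter, Nat.cast_sum]
    refine Finset.sum_le_sum fun b _ => ?_
    split_ifs with h
    · rw [Nat.cast_one]
      exact Real.one_le_exp (mul_nonneg hs0 (sub_nonneg.2 h))
    · rw [Nat.cast_zero]
      exact (Real.exp_pos _).le
  have h2 : ∑ b : Fin n → Fin 2, Real.exp (s * (m - indexWeight b))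
      = Real.exp (s * m) * (1 + Real.exp (-s)) ^ n := by
    have : ∀ b : Fin n → Fin 2, Real.exp (s * (m - indexWeight b))
        = Real.exp (s * m) * ∏ t, Real.exp (-s * ((b t : ℕ) : ℝ)) := by
      intro b
      rw [← Real.exp_sum, ← Real.exp_add, ← Finset.mul_sum]
      congr 1
      rw [indexWeight, Nat.cast_sum]
      ring
    simp only [this]
    rw [← Finset.mul_sum]
    congr 1
    have := Finset.prod_univ_sum (fun _ : Fin n => (Finset.univ : Finset (Fin 2)))
      fun _ x => Real.exp (-s * ((x : ℕ) : ℝ))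
    rw [Fintype.piFinset_univ] at this
    rw [← this]
    simp [Fin.sum_univ_two]
  have h3 : 1 + Real.exp (-s) ≤ 2 * Real.exp (s ^ 2 / 8 - s / 2) := by
    have h := Real.cosh_le_exp_half_sq (s / 2)
    have e : 1 + Real.exp (-s) = 2 * Real.exp (-(s / 2)) * Real.cosh (s / 2) := by
      rw [Real.cosh_eq]
      have e1 : Real.exp (-(s / 2)) * Real.exp (s / 2) = 1 := by rw [← Real.exp_add]; simp
      have e2 : Real.exp (-(s / 2)) * Real.exp (-(s / 2)) = Real.exp (-s) := by
        rw [← Real.exp_add]; ring_nf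
      linear_combination -e1 - e2
    rw [e, show s ^ 2 / 8 - s / 2 = -(s / 2) + (s / 2) ^ 2 / 2 by ring, Real.exp_add, ← mul_assoc]
    exact mul_le_mul_of_nonneg_left h (by positivity)
  calc _ ≤ Real.exp (s * m) * (1 + Real.exp (-s)) ^ n := h1.trans h2.le
    _ ≤ Real.exp (s * m) * (2 * Real.exp (s ^ 2 / 8 - s / 2)) ^ n := by gcongr
    _ = 2 ^ n * Real.exp (-((n - 2 * m) ^ 2 / (2 * n))) := by
      rw [mul_pow, ← Real.exp_nat_mul, mul_left_comm, ← Real.exp_add]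
      congr 2
      rw [hs]
      field_simp
      ring

/-- Every unfrozen row of a sufficiently long polar code has large Hamming weight. -/
theorem Channel.IsPolarCode.log_div_log_le {W : Channel.{u}} {C : ℝ}
    (hC : C ∈ Set.Ioo (0 : ℝ) 1) (hZ : W.bhattacharyya ∈ Set.Ioo (0 : ℝ) 1)
    {Pe : ℝ} {n : ℕ}
    (hn : (2 : ℝ) ^ nBar W.bhattacharyya C Pe < 2 ^ n)
    {A : Finset (Fin n → Fin 2)} (hA : W.IsPolarCode A) (hR : polarRate A ≤ C)
    {i : Fin n → Fin 2} (hi : i ∈ A) :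
    Real.log (Pe / 8) / Real.log W.bhattacharyya ≤ 2 ^ indexWeight i := by
  by_contra! hlt
  obtain ⟨hZ0, hZ1⟩ := hZ
  set Z := W.bhattacharyya
  set D := Real.log (Pe / 8) / Real.log Z with hD
  set m := mBar Z Pe with hm
  set c := -Real.log (1 - C) with hc
  set w := indexWeight i with hw
  have hw1 : (1 : ℝ) ≤ 2 ^ w := one_le_pow₀ one_le_two
  have hD1 : 1 < D := hw1.trans_lt hlt
  set q := Z ^ (4 * D) with hq
  have hq0 : 0 < q := Real.rpow_pos_of_pos hZ0 _
  have hqZ : q < Z := by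
    have := Real.rpow_lt_rpow_of_exponent_gt hZ0 hZ1 (show 1 < 4 * D by linarith)
    rwa [Real.rpow_one] at this
  have hlZ : Real.log (1 - Z) < 0 := Real.log_neg (by linarith) (by linarith)
  have hlq : Real.log (1 - q) < 0 := Real.log_neg (by linarith) (by linarith)
  have hlqZ : Real.log (1 - Z) < Real.log (1 - q) := Real.log_lt_log (by linarith) (by linarith)
  have hratio : 1 < Real.log (1 - Z) / Real.log (1 - q) := (one_lt_div_of_neg hlq).2 hlqZ
  -- The definition of `mBar` in usable form. The argument of its logarithm is positive because the
  -- assumption `2 ^ w < D` forces `D > 1`.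
  have h2m : (2 : ℝ) ^ m = 2 * D * (Real.log (1 - Z) / Real.log (1 - q)) := by
    have e : (2 * Real.log (Pe / 8) * Real.log (1 - Z)) /
        (Real.log Z * Real.log (1 - Z ^ (4 * Real.log (Pe / 8) / Real.log Z)))
        = 2 * D * (Real.log (1 - Z) / Real.log (1 - q)) := by
      rw [mul_div_assoc 4, ← hD, ← hq, mul_div_mul_comm, mul_div_assoc 2]
    rw [hm, mBar, e, Real.rpow_logb two_pos (by norm_num)]
    exact mul_pos (by linarith) (by linarith)
  have hm0 : 0 < m := by
    by_contra! h
    have h1 : (2 : ℝ) ^ m ≤ 1 := Real.rpow_le_one_of_one_le_of_nonpos one_le_two h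
    rw [h2m] at h1
    nlinarith [mul_lt_mul_of_pos_left hratio (zero_lt_one.trans hD1)]
  have hc0 : 0 < c := neg_pos.2 (Real.log_neg (by linarith [hC.2]) (by linarith [hC.1]))
  have hnBar : 2 * m + c + √(4 * m * c + c ^ 2) < n := by
    rw [← Real.rpow_natCast, Real.rpow_lt_rpow_left_iff one_lt_two] at hn
    refine lt_of_eq_of_lt ?_ hn
    rw [nBar, ← hm, hc]
    ring_nf
  have hsq := Real.sq_sqrt (show 0 ≤ 4 * m * c + c ^ 2 by positivity)
  have hs0 := Real.sqrt_nonneg (4 * m * c + c ^ 2)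
  have hn0 : (0 : ℝ) < n := by linarith
  -- `nBar` is the larger root in `n` of `(n - 2m)² = 2 n c`.
  have hexp : c < ((n : ℝ) - 2 * m) ^ 2 / (2 * n) := by
    rw [lt_div_iff₀ (by linarith)]
    nlinarith [mul_self_lt_mul_self hs0
      (show √(4 * m * c + c ^ 2) < (n : ℝ) - 2 * m - c by linarith)]
  -- Fewer than `(1 - C) 2^n` indices have weight at most `m`, whereas at least that many are
  -- frozen.
  obtain ⟨j, hj, hjm⟩ : ∃ j ∉ A, m < indexWeight j := by
    by_contra! h
    have h1 := card_indexWeight_le n m (by exact_mod_cast hn0) (by linarith)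
    have h2 : Real.exp (-(((n : ℝ) - 2 * m) ^ 2 / (2 * n))) < 1 - C := by
      rw [← Real.exp_log (show 0 < 1 - C by linarith [hC.2])]
      refine Real.exp_lt_exp.2 ?_
      linarith
    have h3 : (2 : ℝ) ^ n ≤ A.card
        + (Finset.univ.filter fun b : Fin n → Fin 2 => (indexWeight b : ℝ) ≤ m).card := by
      have : (Finset.univ : Finset (Fin n → Fin 2))
          ⊆ A ∪ Finset.univ.filter fun b : Fin n → Fin 2 => (indexWeight b : ℝ) ≤ m := by
        intro b _
        by_cases hb : b ∈ A
        · exact Finset.mem_union_left _ hb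
        · exact Finset.mem_union_right _ (by simpa using h b hb)
      have := (Finset.card_le_card this).trans (Finset.card_union_le _ _)
      rw [Finset.card_univ, Fintype.card_fun, Fintype.card_fin, Fintype.card_fin] at this
      exact_mod_cast this
    have h4 : (A.card : ℝ) ≤ C * 2 ^ n := (div_le_iff₀ (by positivity)).1 hR
    have h5 := mul_lt_mul_of_pos_left h2 (show (0 : ℝ) < 2 ^ n by positivity)
    linarith
  have hZi0 := (W.synthetic n i).bhattacharyya_nonneg
  have hZi1 := (W.synthetic n i).bhattacharyya_le_one
  -- The chain is `1 - Z_j ≤ 1 - Z_i ≤ 1 - Z_i²`, the first step because `i` is unfrozen and `j`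
  -- frozen. Taking logarithms bounds `2 ^ indexWeight j` by `2 ^ w` times the ratio of logarithms,
  -- hence by less than `2 ^ m`.
  have key : (1 - Z) ^ 2 ^ (n - indexWeight j) ≤ (1 - (Z ^ 2) ^ 2 ^ w) ^ 2 ^ (n - w) := by
    refine (W.one_sub_bhattacharyya_synthetic_ge n j).trans
      (le_trans ?_ (W.one_sub_sq_bhattacharyya_synthetic_le n i))
    nlinarith [hA i hi j hj]
  have hqw : q ≤ (Z ^ 2) ^ 2 ^ w := by
    rw [← pow_mul, ← Real.rpow_natCast]
    refine Real.rpow_le_rpow_of_exponent_ge hZ0 hZ1.le ?_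
    push_cast
    linarith
  have hZw : (Z ^ 2) ^ 2 ^ w < 1 :=
    pow_lt_one₀ (sq_nonneg Z) (pow_lt_one₀ hZ0.le hZ1 two_ne_zero) (by positivity)
  have hlog := Real.log_le_log (pow_pos (by linarith) _) key
  rw [Real.log_pow, Real.log_pow, Nat.cast_pow, Nat.cast_pow, Nat.cast_two] at hlog
  have hlog2 : (2 : ℝ) ^ (n - indexWeight j) * Real.log (1 - Z)
      ≤ 2 ^ (n - w) * Real.log (1 - q) :=
    hlog.trans (mul_le_mul_of_nonneg_left
      (Real.log_le_log (by linarith) (by linarith)) (by positivity))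
  rw [pow_sub₀ _ two_ne_zero (indexWeight_le j), pow_sub₀ _ two_ne_zero (indexWeight_le i),
    mul_assoc, mul_assoc] at hlog2
  have hlog3 := le_of_mul_le_mul_left hlog2 (show (0 : ℝ) < 2 ^ n by positivity)
  have hjpos : (0 : ℝ) < 2 ^ indexWeight j := by positivity
  have hlog4 : (2 : ℝ) ^ w * Real.log (1 - Z) ≤ 2 ^ indexWeight j * Real.log (1 - q) := by
    rw [inv_mul_eq_div, inv_mul_eq_div, div_le_div_iff₀ hjpos (by positivity)] at hlog3
    linarith
  have hlog5 : (2 : ℝ) ^ indexWeight j ≤ 2 ^ w * (Real.log (1 - Z) / Real.log (1 - q)) := by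
    rw [← mul_div_assoc, le_div_iff_of_neg hlq]
    exact hlog4
  have hlog6 : (2 : ℝ) ^ m < 2 ^ indexWeight j := by
    rw [← Real.rpow_natCast, Real.rpow_lt_rpow_left_iff one_lt_two]
    exact hjm
  have hlog7 := mul_lt_mul_of_pos_right hlt (zero_lt_one.trans hratio)
  have hlog8 := mul_pos (zero_lt_one.trans hD1) (zero_lt_one.trans hratio)
  linarith

/-! ### Likelihood ratios and the pairwise error bound. -/

namespace Channel

section Law

variable (W : Channel.{u})

instance isProbabilityMeasure_law (x : ZMod 2) : IsProbabilityMeasure (W.law x) := by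
  refine ⟨?_⟩
  rw [law, withDensity_apply _ MeasurableSet.univ, setLIntegral_univ,
    ← ofReal_integral_eq_lintegral_ofReal (W.p_integrable x)
      (Filter.Eventually.of_forall (W.p_nonneg x)), W.p_integral, ENNReal.ofReal_one]

theorem ae_law_pos (x : ZMod 2) : ∀ᵐ y ∂W.law x, 0 < W.p x y := by
  rw [law, ae_withDensity_iff (W.p_measurable x).ennreal_ofReal]
  exact Filter.Eventually.of_forall fun y hy => ENNReal.ofReal_pos.1 (pos_iff_ne_zero.2 hy)

/-- The square root of the likelihood ratio. -/
noncomputable def rootRatio (y : W.Out) : ℝ := √(W.p 1 y / W.p 0 y)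

theorem rootRatio_nonneg (y : W.Out) : 0 ≤ W.rootRatio y := Real.sqrt_nonneg _

theorem rootRatio_measurable : Measurable W.rootRatio :=
  ((W.p_measurable 1).div (W.p_measurable 0)).sqrt

/-- Where `W.p 0 y = 0` both sides vanish, so the default value of the division does no harm. Thus
the root ratio has mean `Z` under input `0`, which is the source of the Bhattacharyya bound. -/
theorem p_mul_rootRatio (y : W.Out) : W.p 0 y * W.rootRatio y = W.geomDensity y := by
  rcases (W.p_nonneg 0 y).eq_or_lt with h | h
  · simp [geomDensity, ← h]
  · rw [rootRatio, geomDensity, ← Real.sqrt_sq h.le, ← Real.sqrt_mul (sq_nonneg _),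
      Real.sqrt_sq h.le]
    congr 1
    field_simp

theorem rootRatio_integrable : Integrable W.rootRatio (W.law 0) := by
  rw [law, integrable_withDensity_iff_integrable_smul' (W.p_measurable 0).ennreal_ofReal
    (Filter.Eventually.of_forall fun _ => ENNReal.ofReal_lt_top)]
  simpa only [ENNReal.toReal_ofReal (W.p_nonneg 0 _), smul_eq_mul, p_mul_rootRatio]
    using W.geomDensity_integrable

theorem integral_rootRatio : ∫ y, W.rootRatio y ∂W.law 0 = W.bhattacharyya := by
  rw [law, integral_withDensity_eq_integral_toReal_smul (W.p_measurable 0).ennreal_ofReal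
    (Filter.Eventually.of_forall fun _ => ENNReal.ofReal_lt_top)]
  simp only [ENNReal.toReal_ofReal (W.p_nonneg 0 _), smul_eq_mul, p_mul_rootRatio]
  rfl

end Law

section BlockRatio

variable (W : Channel.{u}) {ι : Type*} [Fintype ι]

instance isProbabilityMeasure_blockLaw (c : ι → ZMod 2) :
    IsProbabilityMeasure (W.blockLaw c) := by
  unfold blockLaw
  infer_instance

theorem likelihood_measurable (c : ι → ZMod 2) : Measurable (W.likelihood c) :=
  Finset.measurable_fun_prod _ fun i _ => (W.p_measurable (c i)).comp (measurable_pi_apply i)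

theorem ae_blockLaw_pos : ∀ᵐ y ∂W.blockLaw (0 : ι → ZMod 2), ∀ i, 0 < W.p 0 (y i) := by
  rw [ae_all_iff]
  intro i
  exact (Measure.tendsto_eval_ae_ae (μ := fun _ : ι => W.law 0) (i := i)).eventually
    (W.ae_law_pos 0)

/-- The square root of the likelihood ratio of the word `c` to the zero word. -/
noncomputable def blockRootRatio (c : ι → ZMod 2) (y : ι → W.Out) : ℝ :=
  ∏ i, if c i = 0 then 1 else W.rootRatio (y i)

theorem blockRootRatio_nonneg (c : ι → ZMod 2) (y : ι → W.Out) : 0 ≤ W.blockRootRatio c y :=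
  Finset.prod_nonneg fun i _ => by
    split_ifs
    · exact zero_le_one
    · exact W.rootRatio_nonneg _

theorem blockRootRatio_measurable (c : ι → ZMod 2) : Measurable (W.blockRootRatio c) :=
  Finset.measurable_fun_prod _ fun i _ => by
    split_ifs
    · exact measurable_const
    · exact W.rootRatio_measurable.comp (measurable_pi_apply i)

theorem blockRootRatio_mono (c : ι → ZMod 2) {x y : ι → W.Out}
    (h : ∀ i, W.rootRatio (x i) ≤ W.rootRatio (y i)) :
    W.blockRootRatio c x ≤ W.blockRootRatio c y := by
  refine Finset.prod_le_prod (fun i _ => ?_) fun i _ => ?_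
  · split_ifs
    · exact zero_le_one
    · exact W.rootRatio_nonneg _
  · split_ifs
    · exact le_rfl
    · exact h i

theorem _root_.PolarList.zmod_two_eq_one {x : ZMod 2} (h : x ≠ 0) : x = 1 :=
  (Fin.exists_fin_two.1 ⟨(x : Fin 2), rfl⟩).resolve_left h

theorem likelihood_zero_le_iff (c : ι → ZMod 2) {y : ι → W.Out} (hy : ∀ i, 0 < W.p 0 (y i)) :
    W.likelihood 0 y ≤ W.likelihood c y ↔ 1 ≤ W.blockRootRatio c y := by
  have h : W.likelihood c y = W.likelihood 0 y * W.blockRootRatio c y ^ 2 := by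
    rw [likelihood, likelihood, blockRootRatio, ← Finset.prod_pow, ← Finset.prod_mul_distrib]
    refine Finset.prod_congr rfl fun i _ => ?_
    split_ifs with hi
    · simp [hi]
    · rw [zmod_two_eq_one hi, rootRatio,
        Real.sq_sqrt (div_nonneg (W.p_nonneg _ _) (W.p_nonneg _ _))]
      exact (mul_div_cancel₀ _ (hy i).ne').symm
  have h0 : 0 < W.likelihood 0 y := Finset.prod_pos fun i _ => hy i
  rw [h, le_mul_iff_one_le_right h0, one_le_sq_iff₀ (W.blockRootRatio_nonneg c y)]

/-- The Bhattacharyya bound on the pairwise error probability. -/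
theorem blockLaw_blockRootRatio_le (c : ι → ZMod 2) :
    (W.blockLaw (0 : ι → ZMod 2)).real {y | 1 ≤ W.blockRootRatio c y}
      ≤ W.bhattacharyya ^ hammingNorm c := by
  let g : ι → W.Out → ℝ := fun i y => if c i = 0 then 1 else W.rootRatio y
  have hg : ∀ i, Integrable (g i) (W.law 0) := by
    intro i
    by_cases h : c i = 0
    · simpa only [g, h, if_true] using integrable_const (1 : ℝ)
    · simpa only [g, h, if_false] using W.rootRatio_integrable
  have hint : Integrable (W.blockRootRatio c) (W.blockLaw (0 : ι → ZMod 2)) :=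
    Integrable.fintype_prod hg
  -- Markov's inequality; the mean factors over coordinates, with a factor `Z` for each nonzero
  -- symbol of `c`.
  have h := mul_meas_ge_le_integral_of_nonneg
    (Filter.Eventually.of_forall (W.blockRootRatio_nonneg c)) hint 1
  rw [one_mul] at h
  refine h.trans (le_of_eq ?_)
  have e : ∫ y, W.blockRootRatio c y ∂W.blockLaw (0 : ι → ZMod 2)
      = ∏ i, ∫ y, g i y ∂W.law 0 := integral_fintype_prod_eq_prod g
  have e' : ∀ i, ∫ y, g i y ∂W.law 0 = if c i ≠ 0 then W.bhattacharyya else 1 := by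
    intro i
    by_cases h : c i = 0
    · simp [g, h]
    · simp only [g, h, if_false, ne_eq, not_false_eq_true, if_true, integral_rootRatio]
  rw [e]
  simp only [e']
  rw [Finset.prod_ite, Finset.prod_const, Finset.prod_const_one, mul_one]
  rfl

end BlockRatio

/-! ### Reduction to the zero word. -/

section Symmetry

variable (W : Channel.{u}) {ι : Type*} [Fintype ι] {M : Type*}

theorem mapErrorEvent_measurable [Finite M] (enc : M → ι → ZMod 2) (L : ℕ) (m : M) :
    MeasurableSet (W.mapErrorEvent enc L m) := by
  have : W.mapErrorEvent enc L m = ⋃ S ∈ {S : Set M | m ∉ S ∧ L ≤ S.ncard}, ⋂ m' ∈ S,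
      {y | W.likelihood (enc m) y ≤ W.likelihood (enc m') y} := by
    ext y
    simp only [mapErrorEvent, Set.mem_ofPred_eq, Set.mem_iUnion, Set.mem_iInter, exists_prop]
    constructor
    · intro h
      exact ⟨_, ⟨fun hm => hm.1 rfl, h⟩, fun m' hm' => hm'.2⟩
    · rintro ⟨S, ⟨hm, hL⟩, hS⟩
      refine hL.trans (Set.ncard_le_ncard (fun m' hm' => ⟨?_, hS m' hm'⟩) (Set.toFinite _))
      rintro rfl
      exact hm hm'
  rw [this]
  exact MeasurableSet.biUnion (Set.to_countable _) fun S _ =>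
    MeasurableSet.biInter (Set.to_countable _) fun m' _ =>
      measurableSet_le (W.likelihood_measurable _) (W.likelihood_measurable _)

/-- Applying the symmetry `π` at the positions where `enc m` is `1` carries the output law of the
zero word to that of `enc m`, and translates the likelihoods of all messages by `m`. -/
theorem blockLaw_mapErrorEvent_eq [AddCommGroup M] [Finite M] (hW : W.IsSymmetric)
    (enc : M →+ (ι → ZMod 2)) (L : ℕ) (m : M) :
    (W.blockLaw (enc m)).real (W.mapErrorEvent enc L m)
      = (W.blockLaw 0).real (W.mapErrorEvent enc L 0) := by
  obtain ⟨π, hπ, hπm, hp⟩ := hW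
  have hp' : ∀ y, W.p 1 (π y) = W.p 0 y := fun y => by rw [hp, hπ]
  have hlaw : MeasurePreserving π (W.law 0) (W.law 1) := by
    refine ⟨hπm.measurable, ?_⟩
    ext s hs
    rw [Measure.map_apply hπm.measurable hs, law, law, withDensity_apply _ hs,
      withDensity_apply _ (hπm.measurable hs),
      ← hπm.setLIntegral_comp_preimage hs (W.p_measurable 1).ennreal_ofReal]
    simp only [hp']
  let flip : ZMod 2 → W.Out → W.Out := fun a => if a = 0 then id else π
  have hflip : ∀ a, MeasurePreserving (flip a) (W.law 0) (W.law a) := by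
    intro a
    by_cases h : a = 0
    · simpa only [flip, h, if_true] using MeasurePreserving.id _
    · simpa only [flip, zmod_two_eq_one h, one_ne_zero, if_false] using hlaw
  have hflip' : ∀ a b y, W.p b (flip a y) = W.p (b + a) y := by
    intro a b y
    by_cases ha : a = 0
    · simp [flip, ha]
    · rw [zmod_two_eq_one ha]
      simp only [flip, one_ne_zero, if_false]
      by_cases hb : b = 0
      · rw [hb, zero_add, hp]
      · rw [zmod_two_eq_one hb]
        exact hp' y
  have mp : MeasurePreserving (fun (y : ι → W.Out) i => flip (enc m i) (y i))
      (W.blockLaw 0) (W.blockLaw (enc m)) :=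
    measurePreserving_pi (fun _ => W.law 0) (fun i => W.law (enc m i)) fun i => hflip _
  have hlike : ∀ m' y, W.likelihood (enc m') (fun i => flip (enc m i) (y i))
      = W.likelihood (enc (m' + m)) y := by
    intro m' y
    simp only [likelihood, hflip', map_add, Pi.add_apply]
  have hmm : enc (m + m) = 0 := by
    rw [map_add]
    ext i
    exact CharTwo.add_self_eq_zero _
  rw [measureReal_def, measureReal_def,
    ← mp.measure_preimage (W.mapErrorEvent_measurable enc L m).nullMeasurableSet]
  congr 2
  ext y
  simp only [mapErrorEvent, Set.mem_preimage, Set.mem_ofPred_eq, hlike, hmm, map_zero]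
  -- `M` itself need not have exponent two; only the code words do.
  have hneg : ∀ m', enc (m' + m) = enc (m' - m) := by
    intro m'
    rw [map_sub, map_add]
    ext i
    exact (CharTwo.sub_eq_add _ _).symm
  have : {m' : M | m' ≠ 0 ∧ W.likelihood 0 y ≤ W.likelihood (enc m') y}
      = (fun m' => m' - m) ''
        {m' : M | m' ≠ m ∧ W.likelihood 0 y ≤ W.likelihood (enc (m' + m)) y} := by
    ext m'
    constructor
    · rintro ⟨h1, h2⟩
      refine ⟨m' + m, ⟨by simpa using h1, ?_⟩, add_sub_cancel_right _ _⟩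
      rw [hneg, add_sub_cancel_right]
      exact h2
    · rintro ⟨m'', ⟨h1, h2⟩, rfl⟩
      exact ⟨sub_ne_zero.2 h1, hneg m'' ▸ h2⟩
  rw [this, Set.ncard_image_of_injective _ (sub_left_injective (b := m))]

theorem mapError_eq [AddCommGroup M] [Fintype M] (hW : W.IsSymmetric)
    (enc : M →+ (ι → ZMod 2)) (L : ℕ) :
    W.mapError enc L = (W.blockLaw 0).real (W.mapErrorEvent enc L 0) := by
  have h : (Fintype.card M : ℝ) ≠ 0 := Nat.cast_ne_zero.2 Fintype.card_ne_zero
  rw [mapError]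
  simp only [W.blockLaw_mapErrorEvent_eq hW, Finset.sum_const, Finset.card_univ, nsmul_eq_mul]
  rw [inv_mul_cancel_left₀ h]

end Symmetry


/-! ### List errors as unions of increasing events. -/

variable (W : Channel.{u}) {ι : Type*} [Fintype ι] {M : Type*}

/-- The messages that are at least as likely as the message encoded by the zero word. -/
def confusable (enc : M → ι → ZMod 2) (y : ι → W.Out) : Set M :=
  {m | W.likelihood 0 y ≤ W.likelihood (enc m) y}

/-- The inequality becomes strict because the zero message is confusable with itself and is now
counted. -/
theorem mem_mapErrorEvent_zero [AddCommGroup M] [Finite M] (enc : M →+ (ι → ZMod 2)) (L : ℕ)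
    (y : ι → W.Out) :
    y ∈ W.mapErrorEvent enc L 0 ↔ L < (W.confusable enc y).ncard := by
  have h0 : (0 : M) ∈ W.confusable enc y := by
    change W.likelihood 0 y ≤ W.likelihood (enc 0) y
    rw [map_zero]
  have e : {m' : M | m' ≠ 0 ∧ W.likelihood (enc 0) y ≤ W.likelihood (enc m') y}
      = W.confusable enc y \ {0} := by
    ext m
    rw [map_zero]
    exact and_comm
  change L ≤ Set.ncard _ ↔ _
  rw [e, Set.ncard_sdiff_singleton_of_mem h0]
  have := (Set.ncard_pos (Set.toFinite _)).2 ⟨0, h0⟩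
  omega

/-- If a list error occurs precisely when all messages of some set in the family `S` are
confusable, if no set in `S` is likely to be confusable, and if the occurrence of two sets in `S`
forces an error for the list size `L'`, then the error probability for `L'` is at least `3/16` of
the square of that for `L`. -/
theorem three_sixteenths_mul_mapError_le [AddCommGroup M] [Fintype M] (hW : W.IsSymmetric)
    (enc : M →+ (ι → ZMod 2)) (L L' : ℕ) {κ : Type*} [Finite κ] (S : κ → Set M)
    (hsmall : ∀ k, ∃ m ∈ S k, W.bhattacharyya ^ hammingNorm (enc m) ≤ W.mapError enc L / 8)
    (hcover : ∀ y, (∀ i, 0 < W.p 0 (y i)) →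
      (y ∈ W.mapErrorEvent enc L 0 ↔ ∃ k, S k ⊆ W.confusable enc y))
    (hinter : ∀ y, (∀ i, 0 < W.p 0 (y i)) → ∀ k l, k ≠ l → S k ⊆ W.confusable enc y →
      S l ⊆ W.confusable enc y → y ∈ W.mapErrorEvent enc L' 0) :
    3 / 16 * W.mapError enc L ^ 2 ≤ W.mapError enc L' := by
  rw [W.mapError_eq hW] at hsmall
  rw [W.mapError_eq hW, W.mapError_eq hW]
  -- Stated with root ratios, the events are increasing everywhere; they agree with confusability
  -- wherever the zero word has positive likelihood, that is, almost surely.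
  let F : κ → Set (ι → W.Out) := fun k => {y | ∀ m ∈ S k, 1 ≤ W.blockRootRatio (enc m) y}
  have hF : ∀ (k : κ) (y : ι → W.Out), (∀ i, 0 < W.p 0 (y i)) →
      (y ∈ F k ↔ S k ⊆ W.confusable enc y) := fun k y hy =>
    forall₂_congr fun m _ => (W.likelihood_zero_le_iff (enc m) hy).symm
  have hP : (W.blockLaw (0 : ι → ZMod 2)).real (W.mapErrorEvent enc L 0)
      = (W.blockLaw (0 : ι → ZMod 2)).real (⋃ k, F k) := by
    refine measureReal_congr ?_
    filter_upwards [W.ae_blockLaw_pos] with y hy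
    refine propext ((hcover y hy).trans ?_)
    refine (exists_congr fun k => (hF k y hy).symm).trans Set.mem_iUnion.symm
  have hFm : ∀ k, MeasurableSet (F k) := by
    intro k
    have : F k = ⋂ m ∈ S k, {y | 1 ≤ W.blockRootRatio (enc m) y} := by
      ext y
      simp [F]
    rw [this]
    exact MeasurableSet.biInter (Set.to_countable _) fun m _ =>
      measurableSet_le measurable_const (W.blockRootRatio_measurable _)
  rw [hP] at hsmall ⊢
  refine (three_sixteenths_le (μ := W.law 0) W.rootRatio F hFm
    (fun k x y hxy hx m hm => (hx m hm).trans (W.blockRootRatio_mono _ hxy)) fun k => ?_).trans ?_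
  · obtain ⟨m, hm, h⟩ := hsmall k
    refine le_trans ?_ h
    refine le_trans ?_ (W.blockLaw_blockRootRatio_le (enc m))
    exact measureReal_mono (μ := W.blockLaw (0 : ι → ZMod 2)) fun y hy => hy m hm
  · have hT : ∀ s t : Set (ι → W.Out), s ≤ᵐ[W.blockLaw 0] t →
        (W.blockLaw 0).real s ≤ (W.blockLaw 0).real t := fun s t h =>
      ENNReal.toReal_mono (measure_ne_top _ _) (measure_mono_ae h)
    refine hT _ _ ?_
    filter_upwards [W.ae_blockLaw_pos] with y hy
    rintro ⟨k, l, hkl, hk, hl⟩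
    exact hinter y hy k l hkl ((hF k y hy).1 hk) ((hF l y hy).1 hl)

/-- The family consists of the sets of `L + 1` messages containing `0`; two distinct ones cannot fit
into a confusable set of only `L + 1` elements. -/
theorem three_sixteenths_mul_mapError_le_succ [AddCommGroup M] [Fintype M] (hW : W.IsSymmetric)
    (enc : M →+ (ι → ZMod 2)) {L : ℕ} (hL : 1 ≤ L)
    (hsmall : ∀ m ≠ 0, W.bhattacharyya ^ hammingNorm (enc m) ≤ W.mapError enc L / 8) :
    3 / 16 * W.mapError enc L ^ 2 ≤ W.mapError enc (L + 1) := by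
  refine W.three_sixteenths_mul_mapError_le hW enc L (L + 1)
    (κ := {S : Set M // 0 ∈ S ∧ S.ncard = L + 1}) (fun S => S.1) ?_ ?_ ?_
  · rintro ⟨S, hS0, hS⟩
    obtain ⟨m, hm, hm0⟩ := Set.exists_ne_of_one_lt_ncard (s := S) (by omega) 0
    exact ⟨m, hm, hsmall m hm0⟩
  · intro y _
    have h0 : {(0 : M)} ⊆ W.confusable enc y := by
      rintro _ rfl
      change W.likelihood 0 y ≤ W.likelihood (enc 0) y
      rw [map_zero]
    rw [mem_mapErrorEvent_zero]
    constructor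
    · intro h
      obtain ⟨S, hS0, hS, hc⟩ := Set.exists_subsuperset_card_eq (n := L + 1) h0 (by simp) h
      exact ⟨⟨S, hS0 rfl, hc⟩, hS⟩
    · rintro ⟨⟨S, _, hc⟩, hS⟩
      have : S.ncard ≤ _ := Set.ncard_le_ncard hS
      omega
  · rintro y _ ⟨S, _, hS⟩ ⟨T, _, hT⟩ hST hSy hTy
    rw [mem_mapErrorEvent_zero]
    by_contra h
    have h1 : S = _ := Set.eq_of_subset_of_ncard_le hSy (by omega)
    have h2 : T = _ := Set.eq_of_subset_of_ncard_le hTy (by omega)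
    exact hST (Subtype.ext (h1.trans h2.symm))

/-- For a channel whose outputs either determine the input or are uninformative, the confusable
messages form a subgroup. -/
theorem exists_addSubgroup_eq_confusable [AddCommGroup M]
    (hE : ∀ y, 0 < W.p 0 y → W.p 1 y = 0 ∨ W.p 1 y = W.p 0 y) (enc : M →+ (ι → ZMod 2))
    {y : ι → W.Out} (hy : ∀ i, 0 < W.p 0 (y i)) :
    ∃ H : AddSubgroup M, (H : Set M) = W.confusable enc y := by
  -- The messages whose words are supported on the uninformative positions.
  refine ⟨{ carrier := {m | ∀ i, enc m i ≠ 0 → W.p 1 (y i) = W.p 0 (y i)}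
            zero_mem' := fun i hi => by simp at hi
            add_mem' := fun {a b} ha hb i hi => ?_
            neg_mem' := fun {a} ha i hi => ha i (by simpa using hi) }, ?_⟩
  · by_cases h : enc a i = 0
    · refine hb i fun h' => hi ?_
      rw [map_add, Pi.add_apply, h, h', add_zero]
    · exact ha i h
  · ext m
    change (∀ i, enc m i ≠ 0 → W.p 1 (y i) = W.p 0 (y i))
      ↔ W.likelihood 0 y ≤ W.likelihood (enc m) y
    constructor
    · intro h
      refine le_of_eq (Finset.prod_congr rfl fun i _ => ?_)
      by_cases hi : enc m i = 0
      · rw [hi]; rfl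
      · rw [zmod_two_eq_one hi, h i hi]; rfl
    · intro h i hi
      refine (hE _ (hy i)).resolve_left fun h1 => ?_
      have h2 : W.likelihood (enc m) y = 0 :=
        Finset.prod_eq_zero (Finset.mem_univ i) (by rw [zmod_two_eq_one hi, h1])
      have h3 : 0 < W.likelihood 0 y := Finset.prod_pos fun i _ => hy i
      linarith

/-- The family consists of the minimal subgroups with more than `L` elements. For distinct `H` and
`K`, minimality gives `H < H ⊔ K`, so by Lagrange the join has at least twice as many elements as
`H`. -/
theorem three_sixteenths_mul_mapError_le_two_mul [AddCommGroup M] [Fintype M]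
    (hW : W.IsSymmetric) (hE : ∀ y, 0 < W.p 0 y → W.p 1 y = 0 ∨ W.p 1 y = W.p 0 y)
    (enc : M →+ (ι → ZMod 2)) {L : ℕ} (hL : 1 ≤ L)
    (hsmall : ∀ m ≠ 0, W.bhattacharyya ^ hammingNorm (enc m) ≤ W.mapError enc L / 8) :
    3 / 16 * W.mapError enc L ^ 2 ≤ W.mapError enc (2 * L) := by
  refine W.three_sixteenths_mul_mapError_le hW enc L (2 * L)
    (κ := {H : AddSubgroup M // Minimal (fun H : AddSubgroup M => L < Nat.card H) H}) (fun H => H.1) ?_ ?_ ?_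
  · rintro ⟨H, hH⟩
    have hc : L < (H : Set M).ncard := hH.prop
    obtain ⟨m, hm, hm0⟩ := Set.exists_ne_of_one_lt_ncard (s := (H : Set M)) (by omega) 0
    exact ⟨m, hm, hsmall m hm0⟩
  · intro y hy
    obtain ⟨B, hB⟩ := W.exists_addSubgroup_eq_confusable hE enc hy
    rw [mem_mapErrorEvent_zero, ← hB]
    constructor
    · intro h
      obtain ⟨H, hHB, hH⟩ := exists_minimal_le_of_wellFoundedLT
        (fun H : AddSubgroup M => L < Nat.card H) B h
      exact ⟨⟨H, hH⟩, hHB⟩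
    · rintro ⟨⟨H, hH⟩, hHB⟩
      exact lt_of_lt_of_le hH.prop (Set.ncard_le_ncard hHB)
  · rintro y hy ⟨H, hH⟩ ⟨K, hK⟩ hHK hHy hKy
    obtain ⟨B, hB⟩ := W.exists_addSubgroup_eq_confusable hE enc hy
    rw [mem_mapErrorEvent_zero]
    rw [← hB] at hHy hKy ⊢
    have hle : H ⊔ K ≤ B := sup_le hHy hKy
    have hne : H ≠ H ⊔ K := by
      intro h
      have hKH : K ≤ H := by rw [h]; exact le_sup_right
      exact hHK (Subtype.ext (le_antisymm (hH.le_of_le hK.prop hKH) hKH))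
    obtain ⟨q, hq⟩ := AddSubgroup.card_dvd_of_le (le_sup_left : H ≤ H ⊔ K)
    have hq2 : 2 ≤ q := by
      by_contra! h
      refine hne (AddSubgroup.eq_of_le_of_card_ge le_sup_left ?_)
      rw [hq]
      exact (Nat.mul_le_mul_left _ (Nat.lt_succ_iff.1 h)).trans (mul_one _).le
    have h1 : L < Nat.card H := hH.prop
    have h2 : Nat.card (H ⊔ K : AddSubgroup M) ≤ (B : Set M).ncard := Set.ncard_le_ncard hle
    have h3 := Nat.mul_le_mul_left (Nat.card H) hq2
    omega

end Channel

/-! ### Application to polar codes and the erasure channel. -/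

theorem BEC_p_one_eq (ε : ℝ) (h : ε ∈ Set.Icc (0 : ℝ) 1) (y : (BEC.{u} ε h).Out)
    (hy : 0 < (BEC.{u} ε h).p 0 y) :
    (BEC.{u} ε h).p 1 y = 0 ∨ (BEC.{u} ε h).p 1 y = (BEC.{u} ε h).p 0 y := by
  change 0 < erasureProb ε 0 y at hy
  change erasureProb ε 1 y = 0 ∨ erasureProb ε 1 y = erasureProb ε 0 y
  cases y with
  | bit b =>
    left
    by_cases hb : b = 0
    · simp [erasureProb, hb]
    · simp [erasureProb, hb] at hy
  | erased => exact Or.inr rfl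

/-- The encoder of a polar code as a group homomorphism. -/
def polarEncodeHom {n : ℕ} (A : Finset (Fin n → Fin 2)) :
    (A → ZMod 2) →+ ((Fin n → Fin 2) → ZMod 2) :=
  AddMonoidHom.mk' (polarEncode A) (polarEncode_add A)

theorem Channel.IsPolarCode.bhattacharyya_pow_le {W : Channel.{u}} {C : ℝ}
    (hC : C ∈ Set.Ioo (0 : ℝ) 1) (hZ : W.bhattacharyya ∈ Set.Ioo (0 : ℝ) 1)
    {Pe : ℝ} (hPe : 0 < Pe) {n : ℕ}
    (hn : (2 : ℝ) ^ nBar W.bhattacharyya C Pe < 2 ^ n)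
    {A : Finset (Fin n → Fin 2)} (hA : W.IsPolarCode A) (hR : polarRate A ≤ C)
    {m : A → ZMod 2} (hm : m ≠ 0) :
    W.bhattacharyya ^ hammingNorm (polarEncode A m) ≤ Pe / 8 := by
  obtain ⟨i₀, -⟩ := Function.ne_iff.1 hm
  obtain ⟨i, hi, hmin⟩ := A.exists_min_image indexWeight ⟨i₀, i₀.2⟩
  have h1 := hA.log_div_log_le hC hZ hn hR hi
  have h2 := two_pow_le_hammingNorm_polarEncode A hmin m hm
  have h3 : Real.log (Pe / 8) / Real.log W.bhattacharyya ≤ hammingNorm (polarEncode A m) :=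
    h1.trans (by exact_mod_cast h2)
  rw [div_le_iff_of_neg (Real.log_neg hZ.1 hZ.2)] at h3
  rw [← Real.log_le_log_iff (pow_pos hZ.1 _) (by positivity), Real.log_pow]
  exact h3

end PolarList

theorem theorem2 (W : PolarList.Channel.{u}) (hsymm : W.IsSymmetric)
    (hC : W.capacity ∈ Set.Ioo (0 : ℝ) 1) (hZ : W.bhattacharyya ∈ Set.Ioo (0 : ℝ) 1)
    (Pe : ℝ) (hPe : Pe ∈ Set.Ioo (0 : ℝ) 1) (L : ℕ) (hL : 1 ≤ L)
    (n : ℕ) (hn : (2 : ℝ) ^ PolarList.nBar W.bhattacharyya W.capacity Pe < 2 ^ n)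
    (A : Finset (Fin n → Fin 2)) (hA : W.IsPolarCode A)
    (hR : PolarList.polarRate A ≤ W.capacity)
    (hErr : Pe < PolarList.polarMapError W A L) :
    3 / 16 * PolarList.polarMapError W A L ^ 2 ≤ PolarList.polarMapError W A (L + 1) ∧
      ∀ (ε : ℝ) (hε : ε ∈ Set.Icc (0 : ℝ) 1), W = PolarList.BEC.{u} ε hε →
        3 / 16 * PolarList.polarMapError W A L ^ 2 ≤ PolarList.polarMapError W A (2 * L) := by
  -- The assumption that the error probability exceeds `Pe` turns the bound `Pe / 8` into one eighth
  -- of the error probability itself.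
  have hsmall : ∀ m ≠ 0, W.bhattacharyya ^ hammingNorm (PolarList.polarEncodeHom A m)
      ≤ W.mapError (PolarList.polarEncodeHom A) L / 8 := fun m hm =>
    (hA.bhattacharyya_pow_le hC hZ hPe.1 hn hR hm).trans
      (div_le_div_of_nonneg_right hErr.le (by norm_num))
  refine ⟨W.three_sixteenths_mul_mapError_le_succ hsymm (PolarList.polarEncodeHom A) hL hsmall,
    fun ε hε hW => ?_⟩
  refine W.three_sixteenths_mul_mapError_le_two_mul hsymm ?_ (PolarList.polarEncodeHom A) hL hsmall
  subst hW
  exact PolarList.BEC_p_one_eq ε hε
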